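/- Let $\Omega\subset\mathbb R^2$ be a bounded open set (in particular, a bounded Lipschitz domain), let $\epsilon,\alpha_0,\alpha_1>0$ and put $\kappa(t)=\alpha_0\sinh(\alpha_1 t)$. Let $H^1_0(\Omega)$ be the closure of $C_c^\infty(\Omega)$ in the $H^1(\Omega)$ norm, let $\|\cdot\|$ be the norm of $L^2(\Omega)$ (or $L^2(\Omega)^2$), and let $C_P$ be the Poincaré constant of $\Omega$, the least $C\ge 0$ with $\|\varphi\|\le C\|\nabla\varphi\|$ for all $\varphi\in H^1_0(\Omega)$. For $u\in H^1_0(\Omega)^2$ and $\varphi,\xi\in H^1_0(\Omega)$ put $$c_p(u;\varphi,\xi)=\int_\Omega (u\cdot\nabla\varphi)\,\xi,\qquad c_p^{skew}(u;\varphi,\xi)=\tfrac12\big(c_p(u;\varphi,\xi)-c_p(u;\xi,\varphi)\big).$$ Theorem. Let $g\in L^2(\Omega)$ and $u\in H^1_0(\Omega)^2$. Then the nonlinear Poisson–Boltzmann transport problem with skew-symmetrized convection has a unique solution: there is exactly one $\psi\in H^1_0(\Omega)$ such that, for every $\varphi\in H^1_0(\Omega)$, the function $\kappa(\psi)\varphi$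 is integrable on $\Omega$ and $$\int_\Omega \epsilon\,\nabla\psi\cdot\nabla\varphi + c_p^{skew}(u;\psi,\varphi)+\int_\Omega\kappa(\psi)\,\varphi=\int_\Omega g\,\varphi .$$ This $\psi$ is bounded, that is, there are real $\Lambda_*\le 0\le\Lambda^*$ with $\Lambda_*\le\psi\le\Lambda^*$ almost everywhere in $\Omega$, and it satisfies $$\|\nabla\psi\|\le\frac{C_P}{\epsilon}\,\|g\| .$$ If moreover $\nabla\cdot u=0$ in $\Omega$, then $\psi$ is also the unique solution in $H^1_0(\Omega)$, in the same sense, of the problem with $c_p$ in place of $c_p^{skew}$. -/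

import Mathlib

open MeasureTheory Set
open scoped ContDiff

noncomputable section

namespace PoissonBoltzmann

/-- The Euclidean plane. -/
abbrev Plane : Type := EuclideanSpace ℝ (Fin 2)

/-- `L²(Ω)`, real-valued. -/
abbrev L2 (Ω : Set Plane) : Type := Lp ℝ 2 (volume.restrict Ω)

/-- `L²(Ω)²`, with norm `(∫_Ω |G|²)^(1/2)`, `|·|` the Euclidean norm. -/
abbrev L2Vec (Ω : Set Plane) : Type := Lp Plane 2 (volume.restrict Ω)

/-- Pairs (function, vector field) in `L²(Ω) × L²(Ω)²`, with the norm
`(‖f‖² + ‖G‖²)^(1/2)`. On the pairs `(f, ∇f)` this is the `H¹(Ω)` norm. -/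
abbrev L2Pair (Ω : Set Plane) : Type := WithLp 2 (L2 Ω × L2Vec Ω)

/-- Smooth functions with compact support contained in `Ω`. -/
def IsTest (Ω : Set Plane) (η : Plane → ℝ) : Prop :=
  ContDiff ℝ ∞ η ∧ HasCompactSupport η ∧ tsupport η ⊆ Ω

/-- The pairs `(η, ∇η)` with `η` a test function on `Ω`. -/
def testPairs (Ω : Set Plane) : Set (L2Pair Ω) :=
  {p | ∃ η : Plane → ℝ, IsTest Ω η ∧
    p.fst =ᵐ[volume.restrict Ω] η ∧ p.snd =ᵐ[volume.restrict Ω] fun x => gradient η x}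

/-- `H¹₀(Ω)`: the closure of the test functions in the `H¹(Ω)` norm. An element carries the
function (first component) and its weak gradient (second component, see
`hasWeakGradient_grad`). -/
def H10 (Ω : Set Plane) : Submodule ℝ (L2Pair Ω) :=
  (Submodule.span ℝ (testPairs Ω)).topologicalClosure

/-- The function underlying an element of `H¹₀(Ω)`. -/
def fn {Ω : Set Plane} (φ : H10 Ω) : L2 Ω := φ.val.fst

/-- The weak gradient of an element of `H¹₀(Ω)`. -/
def grad {Ω : Set Plane} (φ : H10 Ω) : L2Vec Ω := φ.val.snd

/-- `G` is the weak gradient of `f` on `Ω`. -/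
def HasWeakGradient (Ω : Set Plane) (f : Plane → ℝ) (G : Plane → Plane) : Prop :=
  ∀ η : Plane → ℝ, IsTest Ω η → ∀ i : Fin 2,
    ∫ x in Ω, f x * gradient η x i = - ∫ x in Ω, G x i * η x

/-- The second component of an element of `H¹₀(Ω)` is the weak gradient of the first. -/
theorem hasWeakGradient_grad {Ω : Set Plane} (φ : H10 Ω) :
    HasWeakGradient Ω (fun x => fn φ x) (fun x => grad φ x) := by
  intro η hη i
  obtain ⟨hs, hc, hsub⟩ := hη
  set e : Plane := EuclideanSpace.single i 1 with he
  have hgi : ∀ (ζ : Plane → ℝ) (x : Plane), gradient ζ x i = fderiv ℝ ζ x e := by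
    intro ζ x
    have h := InnerProductSpace.toDual_symm_apply (𝕜 := ℝ) (x := e) (y := fderiv ℝ ζ x)
    rw [← h, he, EuclideanSpace.inner_single_right]
    simp [gradient]
  have hcont : Continuous fun x => gradient η x i := by
    simp only [hgi]
    exact (hs.continuous_fderiv (by simp)).clm_apply continuous_const
  have hcomp : HasCompactSupport fun x => gradient η x i := by
    simp only [hgi]
    exact hc.fderiv_apply (𝕜 := ℝ) e
  have hm1 : MemLp (fun x => gradient η x i) 2 (volume.restrict Ω) :=
    (hcont.memLp_of_hasCompactSupport hcomp).restrict Ω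
  have hm2 : MemLp (fun x => η x • e) 2 (volume.restrict Ω) := by
    refine (Continuous.memLp_of_hasCompactSupport ?_ ?_).restrict Ω
    · exact hs.continuous.smul continuous_const
    · exact hc.smul_right
  let L : L2Pair Ω →L[ℝ] ℝ :=
    (innerSL ℝ (hm1.toLp _)).comp (WithLp.fstL 2 ℝ (L2 Ω) (L2Vec Ω)) +
      (innerSL ℝ (hm2.toLp _)).comp (WithLp.sndL 2 ℝ (L2 Ω) (L2Vec Ω))
  have hL : ∀ p : L2Pair Ω, L p =
      (∫ x in Ω, p.fst x * gradient η x i) + ∫ x in Ω, p.snd x i * η x := by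
    intro p
    have h1 : L p = inner ℝ (hm1.toLp _) p.fst + inner ℝ (hm2.toLp _) p.snd := rfl
    rw [h1, L2.inner_def, L2.inner_def]
    congr 1
    · refine integral_congr_ae ?_
      filter_upwards [hm1.coeFn_toLp] with x hx
      rw [hx]
      simp
    · refine integral_congr_ae ?_
      filter_upwards [hm2.coeFn_toLp] with x hx
      rw [hx, real_inner_smul_left, he, EuclideanSpace.inner_single_left]
      simp [mul_comm]
  have hle : H10 Ω ≤ LinearMap.ker L.toLinearMap := by
    refine Submodule.topologicalClosure_minimal _ ?_ (isClosed_singleton.preimage L.continuous)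
    rw [Submodule.span_le]
    rintro p ⟨ζ, ⟨zs, zc, zsub⟩, h1, h2⟩
    change L p = 0
    rw [hL]
    have e1 : ∫ x in Ω, p.fst x * gradient η x i = ∫ x, ζ x * fderiv ℝ η x e := by
      rw [← setIntegral_eq_integral_of_forall_compl_eq_zero (s := Ω)
        (f := fun x => ζ x * fderiv ℝ η x e)]
      · refine integral_congr_ae ?_
        filter_upwards [h1] with x hx
        rw [hx, hgi]
      · intro x hx
        rw [image_eq_zero_of_notMem_tsupport fun h => hx (zsub h), zero_mul]
    have e2 : ∫ x in Ω, p.snd x i * η x = ∫ x, fderiv ℝ ζ x e * η x := by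
      rw [← setIntegral_eq_integral_of_forall_compl_eq_zero (s := Ω)
        (f := fun x => fderiv ℝ ζ x e * η x)]
      · refine integral_congr_ae ?_
        filter_upwards [h2] with x hx
        rw [hx, hgi]
      · intro x hx
        rw [image_eq_zero_of_notMem_tsupport fun h => hx (hsub h), mul_zero]
    have dη : Continuous fun x => fderiv ℝ η x e :=
      (hs.continuous_fderiv (by simp)).clm_apply continuous_const
    have dζ : Continuous fun x => fderiv ℝ ζ x e :=
      (zs.continuous_fderiv (by simp)).clm_apply continuous_const
    rw [e1, e2, integral_mul_fderiv_eq_neg_fderiv_mul_of_integrable, neg_add_cancel]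
    · exact (dζ.mul hs.continuous).integrable_of_hasCompactSupport hc.mul_left
    · exact (zs.continuous.mul dη).integrable_of_hasCompactSupport zc.mul_right
    · exact (zs.continuous.mul hs.continuous).integrable_of_hasCompactSupport hc.mul_left
    · exact fun x _ => zs.differentiable (by simp) x
    · exact fun x _ => hs.differentiable (by simp) x
  have h0 : L φ.val = 0 := hle φ.property
  rw [hL] at h0
  exact eq_neg_of_add_eq_zero_left h0

/-- Vector fields in `H¹₀(Ω)²`, given by their two components. -/
abbrev Velocity (Ω : Set Plane) : Type := Fin 2 → H10 Ω

/-- `∇ · u = 0` in `Ω`. -/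
def DivFree {Ω : Set Plane} (u : Velocity Ω) : Prop :=
  ∀ᵐ x ∂(volume.restrict Ω), ∑ i : Fin 2, grad (u i) x i = 0

/-- The charge density `κ(t) = α₀ sinh(α₁ t)`. -/
def kappa (α₀ α₁ t : ℝ) : ℝ := α₀ * Real.sinh (α₁ * t)

/-- `a_p(φ, ξ) = ∫_Ω ε ∇φ · ∇ξ`. -/
def diffusionForm {Ω : Set Plane} (ε : ℝ) (φ ξ : H10 Ω) : ℝ :=
  ∫ x in Ω, ε * inner ℝ (grad φ x) (grad ξ x)

/-- `c_p(u; φ, ξ) = ∫_Ω (u · ∇φ) ξ`. -/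
def convectionForm {Ω : Set Plane} (u : Velocity Ω) (φ ξ : H10 Ω) : ℝ :=
  ∫ x in Ω, (∑ i : Fin 2, fn (u i) x * grad φ x i) * fn ξ x

/-- `c_p^skew(u; φ, ξ) = (c_p(u; φ, ξ) - c_p(u; ξ, φ)) / 2`. -/
def skewConvectionForm {Ω : Set Plane} (u : Velocity Ω) (φ ξ : H10 Ω) : ℝ :=
  (1 / 2) * (convectionForm u φ ξ - convectionForm u ξ φ)

/-- `d(φ, ξ) = ∫_Ω κ(φ) ξ`. -/
def reactionForm {Ω : Set Plane} (α₀ α₁ : ℝ) (φ ξ : H10 Ω) : ℝ :=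
  ∫ x in Ω, kappa α₀ α₁ (fn φ x) * fn ξ x

/-- `ψ` solves `a_p(ψ, φ) + c(ψ, φ) + d(ψ, φ) = (g, φ)` for all `φ ∈ H¹₀(Ω)`, where the
integral `d(ψ, φ)` is required to exist; `c` is the convection form. -/
def IsWeakSolution {Ω : Set Plane} (ε α₀ α₁ : ℝ) (c : H10 Ω → H10 Ω → ℝ) (g : L2 Ω)
    (ψ : H10 Ω) : Prop :=
  ∀ φ : H10 Ω,
    Integrable (fun x => kappa α₀ α₁ (fn ψ x) * fn φ x) (volume.restrict Ω) ∧
    diffusionForm ε ψ φ + c ψ φ + reactionForm α₀ α₁ ψ φ = ∫ x in Ω, g x * fn φ x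

/-- The potential takes its values in some interval `[Λ₁, Λ₂]` containing `0`. -/
def IsBoundedPotential {Ω : Set Plane} (ψ : H10 Ω) : Prop :=
  ∃ Λ₁ Λ₂ : ℝ, Λ₁ ≤ 0 ∧ 0 ≤ Λ₂ ∧
    ∀ᵐ x ∂(volume.restrict Ω), Λ₁ ≤ fn ψ x ∧ fn ψ x ≤ Λ₂

/-- The Poincaré constant of `Ω`: the best `C ≥ 0` with `‖φ‖ ≤ C ‖∇φ‖` on `H¹₀(Ω)`. -/
def poincareConst (Ω : Set Plane) : ℝ :=
  sInf {C : ℝ | 0 ≤ C ∧ ∀ φ : H10 Ω, ‖fn φ‖ ≤ C * ‖grad φ‖}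

end PoissonBoltzmann

end

namespace PoissonBoltzmann
section
open Filter Topology
open scoped ENNReal NNReal

variable {Ω : Set Plane}

/-! ### Test functions -/

/-! The diffusion is coercive and the reaction monotone, and the skew-symmetrized convection
vanishes on the diagonal; the difficulty is the exponential growth of `kappa`. So `kappa` is
replaced by `cutKappa`, frozen outside `[-M, M]`, which is Lipschitz and monotone. The operator then
becomes strongly monotone and Lipschitz on `H10 Ω`, and Zarantonello's theorem
(`exists_eq_of_stronglyMonotone`) solves the cut problem. The embedding into `L⁴` makes the
convection form bounded.

To remove the cut, one needs a sup bound that does not depend on it. `exists_forall_abs_fn_le` gives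
`|ψ| ≤ Λ`, where `Λ` depends on `Ω`, `ε`, `u`, `g` but on the reaction term only through its sign `0
≤ f t * t`. Cutting at `M = Λ`, the solution never sees the cut and solves the original problem.

The bound comes from De Giorgi's method. The equation is tested with `w = (ψ - k)⁺`. The reaction
contributes a nonnegative term, and the convection reduces to `-(k/2) ∫ u · ∇w`, which integration
by parts bounds by `(k/2) ‖div u‖ ‖w‖`. Combined with the Sobolev inequality `W^{1,1} ⊂ L²` on the
set `{ψ > k}`, this bounds the measure of `{ψ > h}` by the square of that of `{ψ > k}`, and such
superlinear decay forces it to vanish at a finite level.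

Uniqueness and the energy estimate follow by testing with the difference of two solutions and with
the solution itself. If `div u = 0`, the convection form is already skew, so both problems coincide.
-/

theorem gradient_apply_eq (ζ : Plane → ℝ) (x : Plane) (i : Fin 2) :
    gradient ζ x i = fderiv ℝ ζ x (EuclideanSpace.single i 1) := by
  have h := InnerProductSpace.toDual_symm_apply (𝕜 := ℝ) (x := EuclideanSpace.single i 1)
    (y := fderiv ℝ ζ x)
  rw [← h, EuclideanSpace.inner_single_right]
  simp [gradient]

theorem norm_gradient_eq (ζ : Plane → ℝ) (x : Plane) : ‖gradient ζ x‖ = ‖fderiv ℝ ζ x‖ :=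
  (InnerProductSpace.toDual ℝ Plane).symm.norm_map _

namespace IsTest

variable {η ζ : Plane → ℝ}

theorem continuous (hη : IsTest Ω η) : Continuous η := hη.1.continuous

theorem differentiable (hη : IsTest Ω η) : Differentiable ℝ η := hη.1.differentiable (by simp)

theorem continuous_gradient (hη : IsTest Ω η) : Continuous (gradient η) :=
  (InnerProductSpace.toDual ℝ Plane).symm.continuous.comp (hη.1.continuous_fderiv (by simp))

theorem hasCompactSupport_gradient (hη : IsTest Ω η) : HasCompactSupport (gradient η) :=
  (hη.2.1.fderiv (𝕜 := ℝ)).comp_left (g := (InnerProductSpace.toDual ℝ Plane).symm) (map_zero _)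

theorem memLp (hη : IsTest Ω η) (p : ℝ≥0∞) : MemLp η p (volume.restrict Ω) :=
  (hη.continuous.memLp_of_hasCompactSupport hη.2.1).restrict Ω

theorem memLp_gradient (hη : IsTest Ω η) (p : ℝ≥0∞) :
    MemLp (gradient η) p (volume.restrict Ω) :=
  (hη.continuous_gradient.memLp_of_hasCompactSupport hη.hasCompactSupport_gradient).restrict Ω

theorem zero : IsTest Ω (fun _ => 0) :=
  ⟨contDiff_const, HasCompactSupport.zero, by simp [tsupport]⟩

theorem add (hη : IsTest Ω η) (hζ : IsTest Ω ζ) : IsTest Ω (fun x => η x + ζ x) :=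
  ⟨hη.1.add hζ.1, hη.2.1.add hζ.2.1,
    (tsupport_add η ζ).trans (union_subset hη.2.2 hζ.2.2)⟩

theorem const_mul (c : ℝ) (hη : IsTest Ω η) : IsTest Ω (fun x => c * η x) :=
  ⟨contDiff_const.mul hη.1, hη.2.1.mul_left, tsupport_mul_subset_right.trans hη.2.2⟩

theorem mul (hη : IsTest Ω η) (hζ : IsTest Ω ζ) : IsTest Ω (fun x => η x * ζ x) :=
  ⟨hη.1.mul hζ.1, hη.2.1.mul_right, tsupport_mul_subset_left.trans hη.2.2⟩

theorem comp_left {G : ℝ → ℝ} (hG : ContDiff ℝ ∞ G) (hG0 : G 0 = 0) (hη : IsTest Ω η) :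
    IsTest Ω (fun x => G (η x)) :=
  ⟨hG.comp hη.1, hη.2.1.comp_left hG0, (closure_mono (by
    intro x hx
    simp only [Function.mem_support] at hx ⊢
    intro h
    exact hx (by rw [h, hG0]))).trans hη.2.2⟩

theorem tsupport_subset (hη : IsTest Ω η) : tsupport η ⊆ Ω := hη.2.2

/-- A test function as an element of `H¹₀(Ω)`. -/
noncomputable def toH10 (hη : IsTest Ω η) : H10 Ω :=
  ⟨WithLp.toLp 2 ((hη.memLp 2).toLp η, (hη.memLp_gradient 2).toLp (gradient η)),
    Submodule.le_topologicalClosure _ (Submodule.subset_span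
      ⟨η, hη, (hη.memLp 2).coeFn_toLp, (hη.memLp_gradient 2).coeFn_toLp⟩)⟩

theorem fn_toH10 (hη : IsTest Ω η) : fn hη.toH10 = (hη.memLp 2).toLp η := rfl

theorem coeFn_fn_toH10 (hη : IsTest Ω η) : fn hη.toH10 =ᵐ[volume.restrict Ω] η :=
  (hη.memLp 2).coeFn_toLp

theorem coeFn_grad_toH10 (hη : IsTest Ω η) :
    grad hη.toH10 =ᵐ[volume.restrict Ω] gradient η :=
  (hη.memLp_gradient 2).coeFn_toLp

end IsTest

/-! ### The two components of an element of `H¹₀(Ω)` -/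

/-- The function component as a continuous linear map. -/
noncomputable def fnL (Ω : Set Plane) : H10 Ω →L[ℝ] L2 Ω :=
  (WithLp.fstL 2 ℝ (L2 Ω) (L2Vec Ω)).comp (H10 Ω).subtypeL

/-- The gradient component as a continuous linear map. -/
noncomputable def gradL (Ω : Set Plane) : H10 Ω →L[ℝ] L2Vec Ω :=
  (WithLp.sndL 2 ℝ (L2 Ω) (L2Vec Ω)).comp (H10 Ω).subtypeL

theorem gradL_apply (φ : H10 Ω) : gradL Ω φ = grad φ := rfl

theorem fn_sub (φ ξ : H10 Ω) : fn (φ - ξ) = fn φ - fn ξ := rfl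

theorem fn_neg (φ : H10 Ω) : fn (-φ) = -fn φ := rfl

theorem continuous_fn : Continuous (fn : H10 Ω → L2 Ω) := (fnL Ω).continuous

theorem continuous_grad : Continuous (grad : H10 Ω → L2Vec Ω) := (gradL Ω).continuous

theorem norm_sq_eq (φ : H10 Ω) : ‖φ‖ ^ 2 = ‖fn φ‖ ^ 2 + ‖grad φ‖ ^ 2 :=
  WithLp.prod_norm_sq_eq_of_L2 _

theorem norm_fn_le (φ : H10 Ω) : ‖fn φ‖ ≤ ‖φ‖ :=
  abs_le_of_sq_le_sq' (by rw [norm_sq_eq]; nlinarith [sq_nonneg ‖grad φ‖]) (norm_nonneg _) |>.2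

theorem norm_grad_le (φ : H10 Ω) : ‖grad φ‖ ≤ ‖φ‖ :=
  abs_le_of_sq_le_sq' (by rw [norm_sq_eq]; nlinarith [sq_nonneg ‖fn φ‖]) (norm_nonneg _) |>.2

theorem H10.ext {φ ξ : H10 Ω} (h₁ : fn φ = fn ξ) (h₂ : grad φ = grad ξ) : φ = ξ :=
  Subtype.ext (WithLp.ofLp_injective 2 (Prod.ext h₁ h₂))

theorem H10.isClosed : IsClosed (H10 Ω : Set (L2Pair Ω)) :=
  Submodule.isClosed_topologicalClosure _

instance : CompleteSpace (H10 Ω) := H10.isClosed.completeSpace_coe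

/-- `H¹₀(Ω)` is closed under limits of pairs. -/
theorem H10.exists_of_tendsto {φ : ℕ → H10 Ω} {f : L2 Ω} {G : L2Vec Ω}
    (hf : Tendsto (fun n => fn (φ n)) atTop (𝓝 f))
    (hG : Tendsto (fun n => grad (φ n)) atTop (𝓝 G)) :
    ∃ ξ : H10 Ω, fn ξ = f ∧ grad ξ = G := by
  have h : Tendsto (fun n => (φ n : L2Pair Ω)) atTop (𝓝 (WithLp.toLp 2 (f, G))) :=
    ((WithLp.prod_continuous_toLp 2 (L2 Ω) (L2Vec Ω)).tendsto (f, G)).comp (hf.prodMk_nhds hG)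
  exact ⟨⟨_, H10.isClosed.mem_of_tendsto h (Eventually.of_forall fun n => (φ n).2)⟩, rfl, rfl⟩

/-! ### Density of test functions -/

/-- Test functions form a vector space and the gradient is linear, so taking the span adds nothing
and every element of `H10 Ω` is a limit of genuine test functions. -/
theorem exists_toH10_eq_of_mem_span {p : L2Pair Ω} (hp : p ∈ Submodule.span ℝ (testPairs Ω)) :
    ∃ (η : Plane → ℝ) (hη : IsTest Ω η), (hη.toH10 : L2Pair Ω) = p := by
  have key : ∃ η : Plane → ℝ, IsTest Ω η ∧
      p.fst =ᵐ[volume.restrict Ω] η ∧ p.snd =ᵐ[volume.restrict Ω] fun x => gradient η x := by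
    induction hp using Submodule.span_induction with
    | mem p hp => exact hp
    | zero =>
      refine ⟨_, IsTest.zero, Lp.coeFn_zero _ _ _, (Lp.coeFn_zero _ _ _).trans ?_⟩
      refine Eventually.of_forall fun x => ?_
      simp [gradient]
    | add p q _ _ hp hq =>
      obtain ⟨η, hη, h1, h2⟩ := hp
      obtain ⟨ζ, hζ, h3, h4⟩ := hq
      refine ⟨_, hη.add hζ, ?_, ?_⟩
      · filter_upwards [h1, h3, Lp.coeFn_add p.fst q.fst] with x a b c
        rw [← a, ← b]
        exact c
      · filter_upwards [h2, h4, Lp.coeFn_add p.snd q.snd] with x a b c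
        have : gradient (fun x => η x + ζ x) x = gradient η x + gradient ζ x := by
          simp only [gradient]
          rw [fderiv_fun_add (hη.differentiable x) (hζ.differentiable x), map_add]
        rw [this, ← a, ← b]
        exact c
    | smul c p _ hp =>
      obtain ⟨η, hη, h1, h2⟩ := hp
      refine ⟨_, hη.const_mul c, ?_, ?_⟩
      · filter_upwards [h1, Lp.coeFn_smul c p.fst] with x a b
        rw [← a]
        exact b
      · filter_upwards [h2, Lp.coeFn_smul c p.snd] with x a b
        have : gradient (fun x => c * η x) x = c • gradient η x := by
          simp only [gradient]
          rw [fderiv_const_mul (hη.differentiable x), map_smul]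
        rw [this, ← a]
        exact b
  obtain ⟨η, hη, h1, h2⟩ := key
  refine ⟨η, hη, WithLp.ofLp_injective 2 (Prod.ext ?_ ?_)⟩
  · exact Lp.ext (hη.coeFn_fn_toH10.trans h1.symm)
  · exact Lp.ext (hη.coeFn_grad_toH10.trans h2.symm)

/-- Test functions are dense in `H¹₀(Ω)`. -/
theorem exists_seq_toH10 (φ : H10 Ω) :
    ∃ (η : ℕ → Plane → ℝ) (hη : ∀ n, IsTest Ω (η n)),
      Tendsto (fun n => (hη n).toH10) atTop (𝓝 φ) := by
  have h : (φ : L2Pair Ω) ∈ closure (Submodule.span ℝ (testPairs Ω) : Set (L2Pair Ω)) := φ.2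
  obtain ⟨p, hp, hlim⟩ := mem_closure_iff_seq_limit.1 h
  choose η hη he using fun n => exists_toH10_eq_of_mem_span (hp n)
  refine ⟨η, hη, tendsto_subtype_rng.2 ?_⟩
  simpa only [he] using hlim

/-- A closed property of elements of `H¹₀(Ω)` that holds for test functions holds everywhere. -/
theorem H10.induction {P : H10 Ω → Prop} (hP : IsClosed {φ | P φ})
    (htest : ∀ (η : Plane → ℝ) (hη : IsTest Ω η), P hη.toH10) (φ : H10 Ω) : P φ := by
  obtain ⟨η, hη, hlim⟩ := exists_seq_toH10 φ
  exact hP.mem_of_tendsto hlim (Eventually.of_forall fun n => htest _ (hη n))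

/-! ### Convergence in `L²` -/

/-- A convergent sequence in `H¹₀(Ω)` has a subsequence that converges almost everywhere, together
with the gradients. -/
theorem exists_subseq_tendsto_ae {φ : ℕ → H10 Ω} {ξ : H10 Ω} (h : Tendsto φ atTop (𝓝 ξ)) :
    ∃ ns : ℕ → ℕ, StrictMono ns ∧
      (∀ᵐ x ∂(volume.restrict Ω), Tendsto (fun n => fn (φ (ns n)) x) atTop (𝓝 (fn ξ x))) ∧
      ∀ᵐ x ∂(volume.restrict Ω), Tendsto (fun n => grad (φ (ns n)) x) atTop (𝓝 (grad ξ x)) := by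
  obtain ⟨ns, hns, h1⟩ := (tendstoInMeasure_of_tendsto_Lp
    ((continuous_fn.tendsto ξ).comp h)).exists_seq_tendsto_ae
  obtain ⟨ms, hms, h2⟩ := (tendstoInMeasure_of_tendsto_Lp
    ((continuous_grad.tendsto ξ).comp (h.comp hns.tendsto_atTop))).exists_seq_tendsto_ae
  refine ⟨ns ∘ ms, hns.comp hms, ?_, h2⟩
  filter_upwards [h1] with x hx
  exact hx.comp hms.tendsto_atTop

theorem L2_norm_sq_eq_integral {α E : Type*} [MeasurableSpace α] {μ : Measure α}
    [NormedAddCommGroup E] [InnerProductSpace ℝ E] (f : Lp E 2 μ) :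
    ‖f‖ ^ 2 = ∫ x, ‖f x‖ ^ 2 ∂μ := by
  rw [← real_inner_self_eq_norm_sq, L2.inner_def]
  simp_rw [real_inner_self_eq_norm_sq]

/-- Dominated convergence in `L²`. -/
theorem tendsto_L2_of_dominated {α E : Type*} [MeasurableSpace α] {μ : Measure α}
    [NormedAddCommGroup E] [InnerProductSpace ℝ E] {f : ℕ → Lp E 2 μ} {g : Lp E 2 μ}
    {h : α → ℝ} (hh : MemLp h 2 μ) (hle : ∀ n, ∀ᵐ x ∂μ, ‖f n x‖ ≤ h x)
    (hlim : ∀ᵐ x ∂μ, Tendsto (fun n => f n x) atTop (𝓝 (g x))) :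
    Tendsto f atTop (𝓝 g) := by
  rw [tendsto_iff_norm_sub_tendsto_zero]
  have hsq : Tendsto (fun n => ∫ x, ‖(f n - g) x‖ ^ 2 ∂μ) atTop (𝓝 (∫ _, (0 : ℝ) ∂μ)) := by
    refine tendsto_integral_of_dominated_convergence (fun x => (2 * h x) ^ 2) ?_ ?_ ?_ ?_
    · exact fun n => (Lp.aestronglyMeasurable _).norm.pow 2
    · exact (hh.const_mul 2).integrable_sq
    · intro n
      filter_upwards [ae_all_iff.2 hle, hlim, Lp.coeFn_sub (f n) g] with x h1 h2 h3
      have hg : ‖g x‖ ≤ h x := le_of_tendsto h2.norm (Eventually.of_forall h1)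
      rw [h3, Real.norm_of_nonneg (by positivity)]
      refine pow_le_pow_left₀ (norm_nonneg _) ?_ 2
      calc ‖f n x - g x‖ ≤ ‖f n x‖ + ‖g x‖ := norm_sub_le _ _
        _ ≤ 2 * h x := by linarith [h1 n]
    · filter_upwards [hlim, ae_all_iff.2 fun n => Lp.coeFn_sub (f n) g] with x h2 h3
      simp only [h3, Pi.sub_apply]
      have := ((h2.sub_const (g x)).norm).pow 2
      simpa using this
  simp only [← L2_norm_sq_eq_integral, integral_zero] at hsq
  have := hsq.sqrt
  simpa [Real.sqrt_sq] using this

/-! ### Sobolev and Poincaré inequalities -/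

theorem isFiniteMeasure_restrict (hΩb : Bornology.IsBounded Ω) :
    IsFiniteMeasure (volume.restrict Ω) :=
  ⟨by simpa using hΩb.measure_lt_top⟩

/-- Cauchy-Schwarz against the indicator of `A`. The factor `√(μ.real A)` is the gain that drives
the De Giorgi iteration. -/
theorem integral_norm_le_of_eq_zero_off {α E : Type*} [MeasurableSpace α] {μ : Measure α}
    [IsFiniteMeasure μ] [NormedAddCommGroup E] {A : Set α}
    (hA : MeasurableSet A) (G : Lp E 2 μ) (hG : ∀ᵐ x ∂μ, x ∉ A → G x = 0) :
    ∫ x, ‖G x‖ ∂μ ≤ √(μ.real A) * ‖G‖ := by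
  have hGn : MemLp (fun x => ‖G x‖) 2 μ := (Lp.memLp G).norm
  have h1 : ∫ x, ‖G x‖ ∂μ =
      inner ℝ (indicatorConstLp 2 hA (measure_ne_top μ A) (1 : ℝ)) (hGn.toLp _) := by
    rw [L2.inner_def]
    refine integral_congr_ae ?_
    filter_upwards [hG, hGn.coeFn_toLp,
      indicatorConstLp_coeFn (p := 2) (hs := hA) (hμs := measure_ne_top μ A) (c := (1 : ℝ))]
      with x h2 h3 h4
    rw [h3, h4]
    by_cases hx : x ∈ A
    · simp [hx]
    · simp [hx, h2 hx]
  rw [h1]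
  refine (real_inner_le_norm _ _).trans (le_of_eq ?_)
  rw [norm_indicatorConstLp (by simp) (by simp), Lp.norm_toLp, eLpNorm_norm, ← Lp.norm_def,
    Real.sqrt_eq_rpow]
  simp

/-- On a finite measure space the `L¹` norm is continuous on `L²`, so an inequality with `∫ ‖∇φ‖` on
the right passes from test functions to `H10 Ω`. -/
theorem lipschitzWith_integral_norm {α E : Type*} [MeasurableSpace α] {μ : Measure α}
    [IsFiniteMeasure μ] [NormedAddCommGroup E] :
    LipschitzWith (NNReal.sqrt (μ univ).toNNReal) fun G : Lp E 2 μ => ∫ x, ‖G x‖ ∂μ := by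
  have hint : ∀ G : Lp E 2 μ, Integrable (fun x => ‖G x‖) μ := fun G =>
    ((Lp.memLp G).integrable one_le_two).norm
  refine LipschitzWith.of_le_add_mul _ fun G H => ?_
  have h1 : ∫ x, ‖G x‖ ∂μ ≤ ∫ x, ‖H x‖ ∂μ + ∫ x, ‖(G - H) x‖ ∂μ := by
    rw [← integral_add (hint _) (hint _)]
    refine integral_mono_ae (hint _) ((hint _).add (hint _)) ?_
    filter_upwards [Lp.coeFn_sub G H] with x hx
    simp only [hx, Pi.sub_apply]
    linarith [norm_sub_norm_le (G x) (H x)]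
  refine h1.trans (add_le_add_right ?_ _)
  rw [dist_eq_norm]
  refine (integral_norm_le_of_eq_zero_off MeasurableSet.univ (G - H) (by simp)).trans_eq ?_
  simp [Measure.real, ENNReal.toReal]

theorem IsTest.eLpNorm_restrict {η : Plane → ℝ} (hη : IsTest Ω η) (p : ℝ≥0∞) :
    eLpNorm η p (volume.restrict Ω) = eLpNorm η p volume :=
  eLpNorm_restrict_eq_of_support_subset ((subset_tsupport η).trans hη.tsupport_subset)

theorem IsTest.eLpNorm_fderiv {η : Plane → ℝ} (hη : IsTest Ω η) (p : ℝ≥0∞) :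
    eLpNorm (fderiv ℝ η) p volume = eLpNorm (gradient η) p (volume.restrict Ω) := by
  have hsupp : Function.support (gradient η) ⊆ Ω := by
    intro x hx
    refine hη.tsupport_subset (support_fderiv_subset ℝ ?_)
    rw [Function.mem_support] at hx ⊢
    rwa [← norm_ne_zero_iff, ← norm_gradient_eq, norm_ne_zero_iff]
  rw [eLpNorm_restrict_eq_of_support_subset hsupp]
  exact eLpNorm_congr_norm_ae (Eventually.of_forall fun x => (norm_gradient_eq η x).symm)

/-- The Gagliardo-Nirenberg-Sobolev inequality `W^{1,1} ⊂ L²` in the plane. -/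
theorem exists_norm_fn_le_integral [IsFiniteMeasure (volume.restrict Ω)] :
    ∃ S : ℝ, 0 ≤ S ∧ ∀ φ : H10 Ω, ‖fn φ‖ ≤ S * ∫ x in Ω, ‖grad φ x‖ := by
  refine ⟨eLpNormLESNormFDerivOneConst (volume : Measure Plane) 2, NNReal.coe_nonneg _,
    fun φ => ?_⟩
  refine H10.induction (P := fun φ => ‖fn φ‖ ≤ _ * ∫ x in Ω, ‖grad φ x‖) ?_
    (fun η hη => ?_) φ
  · exact isClosed_le continuous_fn.norm
      (continuous_const.mul (lipschitzWith_integral_norm.continuous.comp continuous_grad))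
  · have hconj : NNReal.HolderConjugate (Module.finrank ℝ Plane : ℝ≥0) 2 := by
      rw [finrank_euclideanSpace_fin]
      exact_mod_cast NNReal.HolderConjugate.two_two
    have h := eLpNorm_le_eLpNorm_fderiv_one (volume : Measure Plane)
      (hη.1.of_le (by simp)) hη.2.1 hconj
    rw [hη.eLpNorm_fderiv, ENNReal.coe_ofNat, ← hη.eLpNorm_restrict] at h
    have hI : ∫ x in Ω, ‖grad hη.toH10 x‖ =
        (eLpNorm (gradient η) 1 (volume.restrict Ω)).toReal := by
      rw [eLpNorm_one_eq_lintegral_enorm, ← integral_norm_eq_lintegral_enorm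
        (hη.memLp_gradient 1).1]
      refine integral_congr_ae ?_
      filter_upwards [hη.coeFn_grad_toH10] with x hx
      rw [hx]
    rw [hI, hη.fn_toH10, Lp.norm_toLp]
    have := ENNReal.toReal_mono
      (ENNReal.mul_ne_top ENNReal.coe_ne_top (hη.memLp_gradient 1).2.ne) h
    rwa [ENNReal.toReal_mul, ENNReal.coe_toReal] at this

/-- `W^{1,1} ⊂ L²` followed by Cauchy-Schwarz on `A`. With `A = univ` it is the Poincaré inequality;
with `A` a superlevel set it is the De Giorgi gain. -/
theorem exists_norm_fn_le_of_grad_eq_zero_off [IsFiniteMeasure (volume.restrict Ω)] :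
    ∃ S : ℝ, 0 ≤ S ∧ ∀ (φ : H10 Ω) (A : Set Plane), MeasurableSet A →
      (∀ᵐ x ∂(volume.restrict Ω), x ∉ A → grad φ x = 0) →
      ‖fn φ‖ ≤ S * (√((volume.restrict Ω).real A) * ‖grad φ‖) := by
  obtain ⟨S, hS, h⟩ := exists_norm_fn_le_integral (Ω := Ω)
  exact ⟨S, hS, fun φ A hA hφ => (h φ).trans
    (mul_le_mul_of_nonneg_left (integral_norm_le_of_eq_zero_off hA _ hφ) hS)⟩

theorem poincareConst_nonneg : 0 ≤ poincareConst Ω := Real.sInf_nonneg fun _ h => h.1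

/-- The Poincaré inequality, with the Poincaré constant. -/
theorem norm_fn_le_poincareConst_mul [IsFiniteMeasure (volume.restrict Ω)]
    (φ : H10 Ω) : ‖fn φ‖ ≤ poincareConst Ω * ‖grad φ‖ := by
  obtain ⟨S, hS, h⟩ := exists_norm_fn_le_of_grad_eq_zero_off (Ω := Ω)
  have hmem : S * √((volume.restrict Ω).real univ) ∈
      {C : ℝ | 0 ≤ C ∧ ∀ φ : H10 Ω, ‖fn φ‖ ≤ C * ‖grad φ‖} := by
    refine ⟨by positivity, fun φ => ?_⟩
    rw [mul_assoc]
    exact h φ univ MeasurableSet.univ (by simp)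
  -- The infimum is itself admissible: divide by `‖grad φ‖`, or, when that is zero, use one concrete
  -- admissible constant.
  rcases (norm_nonneg (grad φ)).eq_or_lt with h0 | h0
  · have := hmem.2 φ
    rw [← h0, mul_zero] at this ⊢
    exact this
  · rw [← div_le_iff₀ h0]
    exact le_csInf ⟨_, hmem⟩ fun C hC => (div_le_iff₀ h0).2 (hC.2 φ)

/-! ### The embedding into `L⁴` -/

/-- In the plane `1/4 = 3/4 - 1/2`, so `W^{1,4/3}` embeds into `L⁴`; Hölder on the bounded set `Ω`
bounds the `L^{4/3}` norm of the gradient by its `L²` norm, at the cost of the factor `|Ω|^{1/4}`.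
-/
theorem exists_eLpNorm_four_le (hΩb : Bornology.IsBounded Ω) :
    ∃ C : ℝ≥0, ∀ η : Plane → ℝ, IsTest Ω η →
      eLpNorm η 4 (volume.restrict Ω) ≤ C * eLpNorm (gradient η) 2 (volume.restrict Ω) := by
  have := isFiniteMeasure_restrict hΩb
  refine ⟨eLpNormLESNormFDerivOfLeConst ℝ (volume : Measure Plane) Ω (4 / 3) 4 *
    (volume.restrict Ω univ ^ (1 / 4 : ℝ)).toNNReal, fun η hη => ?_⟩
  have h := eLpNorm_le_eLpNorm_fderiv_of_le (volume : Measure Plane) (u := η) (s := Ω)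
    (hη.1.of_le (by simp)) ((subset_tsupport η).trans hη.tsupport_subset)
    (p := 4 / 3) (q := 4) (by rw [← NNReal.coe_le_coe]; push_cast; norm_num)
    (by rw [finrank_euclideanSpace_fin, ← NNReal.coe_lt_coe]; push_cast; norm_num)
    (by rw [finrank_euclideanSpace_fin]; push_cast; norm_num) hΩb
  rw [hη.eLpNorm_fderiv, ENNReal.coe_ofNat, ← hη.eLpNorm_restrict] at h
  have h2 := eLpNorm_le_eLpNorm_mul_rpow_measure_univ (μ := volume.restrict Ω)
    (p := ((4 / 3 : ℝ≥0) : ℝ≥0∞)) (q := 2)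
    (by
      rw [show (2 : ℝ≥0∞) = ((2 : ℝ≥0) : ℝ≥0∞) by norm_num, ENNReal.coe_le_coe,
        ← NNReal.coe_le_coe]
      push_cast
      norm_num) (hη.memLp_gradient 2).1
  have hexp : 1 / ((4 / 3 : ℝ≥0) : ℝ≥0∞).toReal - 1 / (2 : ℝ≥0∞).toReal = 1 / 4 := by
    rw [ENNReal.coe_toReal]
    push_cast
    norm_num
  rw [hexp] at h2
  refine h.trans ((mul_le_mul_right h2 _).trans_eq ?_)
  rw [ENNReal.coe_mul, ENNReal.coe_toNNReal (by finiteness)]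
  ring

instance : Fact ((1 : ℝ≥0∞) ≤ 4) := ⟨by norm_num⟩

instance : ENNReal.HolderTriple 4 4 2 := ⟨by
  rw [← two_mul, show (4 : ℝ≥0∞) = 2 * 2 by norm_num,
    ENNReal.mul_inv (by simp) (by simp), ← mul_assoc, ENNReal.mul_inv_cancel (by simp) (by simp),
    one_mul]⟩

/-- The embedding `H¹₀(Ω) ⊂ L⁴(Ω)`. -/
theorem exists_embedding_four (hΩb : Bornology.IsBounded Ω) :
    ∃ J : H10 Ω →L[ℝ] Lp ℝ 4 (volume.restrict Ω),
      ∀ φ : H10 Ω, J φ =ᵐ[volume.restrict Ω] fn φ := by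
  obtain ⟨C, hC⟩ := exists_eLpNorm_four_le hΩb
  have hbound : ∀ φ : H10 Ω, eLpNorm (fn φ) 4 (volume.restrict Ω) ≤ C * ‖grad φ‖ₑ := by
    intro φ
    obtain ⟨η, hη, hlim⟩ := exists_seq_toH10 φ
    obtain ⟨ns, hns, h1, -⟩ := exists_subseq_tendsto_ae hlim
    -- Fatou along an almost everywhere convergent subsequence of test functions; convergence in
    -- `L⁴` need not be known.
    refine (Lp.eLpNorm_lim_le_liminf_eLpNorm (fun n => Lp.aestronglyMeasurable _) _ h1).trans ?_
    have h2 : Tendsto (fun n => (C : ℝ≥0∞) * ‖grad (hη (ns n)).toH10‖ₑ) atTop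
        (𝓝 (C * ‖grad φ‖ₑ)) :=
      ENNReal.Tendsto.const_mul ((continuous_enorm.comp continuous_grad).tendsto φ |>.comp
        (hlim.comp hns.tendsto_atTop)) (Or.inr ENNReal.coe_ne_top)
    rw [← h2.liminf_eq]
    refine liminf_le_liminf (Eventually.of_forall fun n => ?_)
    rw [eLpNorm_congr_ae (hη (ns n)).coeFn_fn_toH10, Lp.enorm_def,
      eLpNorm_congr_ae (hη (ns n)).coeFn_grad_toH10]
    exact hC _ (hη (ns n))
  have hmem : ∀ φ : H10 Ω, MemLp (fn φ) 4 (volume.restrict Ω) := fun φ =>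
    ⟨Lp.aestronglyMeasurable _, (hbound φ).trans_lt (by finiteness)⟩
  let J : H10 Ω →ₗ[ℝ] Lp ℝ 4 (volume.restrict Ω) :=
    { toFun := fun φ => (hmem φ).toLp _
      map_add' := fun φ ξ => by
        rw [← MemLp.toLp_add]
        exact MemLp.toLp_congr _ _ (Lp.coeFn_add (fn φ) (fn ξ))
      map_smul' := fun c φ => by
        rw [RingHom.id_apply, ← MemLp.toLp_const_smul]
        exact MemLp.toLp_congr _ _ (Lp.coeFn_smul c (fn φ)) }
  refine ⟨J.mkContinuous C fun φ => ?_, fun φ => (hmem φ).coeFn_toLp⟩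
  change ‖(hmem φ).toLp _‖ ≤ _
  rw [Lp.norm_toLp]
  have h := ENNReal.toReal_mono (by finiteness) (hbound φ)
  rw [ENNReal.toReal_mul, ENNReal.coe_toReal, toReal_enorm] at h
  exact h.trans (mul_le_mul_of_nonneg_left (norm_grad_le φ) C.2)

/-! ### The convection form -/

theorem real_inner_eq_mul (a b : ℝ) : inner ℝ a b = a * b := by
  rw [real_inner_eq_re_inner]; simp [mul_comm]


/-- The `i`-th partial derivative as a continuous linear map into `L²(Ω)`. -/
noncomputable def partialL (Ω : Set Plane) (i : Fin 2) : H10 Ω →L[ℝ] L2 Ω :=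
  ((EuclideanSpace.proj i : Plane →L[ℝ] ℝ).compLpL 2 (volume.restrict Ω)).comp (gradL Ω)

theorem coeFn_partialL (i : Fin 2) (φ : H10 Ω) :
    partialL Ω i φ =ᵐ[volume.restrict Ω] fun x => grad φ x i :=
  ContinuousLinearMap.coeFn_compLpL _ _

/-- The bounded bilinear form `(x, y) ↦ ⟪A x, B y⟫`. -/
theorem exists_bilin_inner {E F : Type*} [NormedAddCommGroup E] [NormedSpace ℝ E]
    [NormedAddCommGroup F] [InnerProductSpace ℝ F] (A B : E →L[ℝ] F) :
    ∃ T : E →L[ℝ] E →L[ℝ] ℝ, ∀ x y, T x y = inner ℝ (A x) (B y) :=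
  ⟨(innerSL ℝ).bilinearComp A B, fun _ _ => rfl⟩

/-- The convection form is a bounded bilinear form. -/
theorem exists_convectionForm_eq (hΩb : Bornology.IsBounded Ω) (u : Velocity Ω) :
    ∃ T : H10 Ω →L[ℝ] H10 Ω →L[ℝ] ℝ, (∀ φ ξ, convectionForm u φ ξ = T φ ξ) ∧
      ∀ (φ ξ : H10 Ω) (i : Fin 2), Integrable (fun x => fn (u i) x * grad φ x i * fn ξ x) (volume.restrict Ω) := by
  obtain ⟨J, hJ⟩ := exists_embedding_four hΩb
  -- The product of `u i` and `ξ`, both in `L⁴`, lies in `L²` and is paired there with the partial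
  -- derivative of `φ`.
  let P := (ContinuousLinearMap.mul ℝ ℝ).holderL (volume.restrict Ω) 4 4 2
  have hae : ∀ (φ ξ : H10 Ω) (i : Fin 2),
      (fun x => inner ℝ (partialL Ω i φ x) (P (J (u i)) (J ξ) x)) =ᵐ[volume.restrict Ω]
        fun x => fn (u i) x * grad φ x i * fn ξ x := by
    intro φ ξ i
    filter_upwards [coeFn_partialL i φ, hJ (u i), hJ ξ,
      (ContinuousLinearMap.mul ℝ ℝ).coeFn_holder (r := 2) (J (u i)) (J ξ)] with x h1 h2 h3 h4
    have h4' : P (J (u i)) (J ξ) x = fn (u i) x * fn ξ x := by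
      rw [← h2, ← h3]
      exact h4
    rw [h1, h4', real_inner_eq_mul]
    ring
  have hint : ∀ (φ ξ : H10 Ω) (i : Fin 2),
      Integrable (fun x => fn (u i) x * grad φ x i * fn ξ x) (volume.restrict Ω) :=
    fun φ ξ i => (L2.integrable_inner _ _).congr (hae φ ξ i)
  choose T hT using fun i => exists_bilin_inner (partialL Ω i) ((P (J (u i))).comp J)
  refine ⟨∑ i, T i, fun φ ξ => ?_, hint⟩
  simp only [convectionForm, Finset.sum_mul]
  rw [integral_finsetSum _ fun i _ => hint φ ξ i]
  simp only [sum_apply]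
  refine Finset.sum_congr rfl fun i _ => ?_
  rw [← integral_congr_ae (hae φ ξ i), ← L2.inner_def, hT]
  rfl

/-- Integration by parts in `H¹₀(Ω)`. -/
theorem inner_fn_partialL (i : Fin 2) (φ ξ : H10 Ω) :
    inner ℝ (fn φ) (partialL Ω i ξ) = -inner ℝ (partialL Ω i φ) (fn ξ) := by
  refine H10.induction (P := fun ξ => inner ℝ (fn φ) (partialL Ω i ξ) =
    -inner ℝ (partialL Ω i φ) (fn ξ)) ?_ (fun η hη => ?_) ξ
  · exact isClosed_eq (continuous_const.inner (partialL Ω i).continuous)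
      (continuous_const.inner continuous_fn).neg
  · have h := hasWeakGradient_grad φ η hη i
    rw [L2.inner_def, L2.inner_def]
    convert h using 1
    · refine integral_congr_ae ?_
      filter_upwards [coeFn_partialL i hη.toH10, hη.coeFn_grad_toH10] with x h1 h2
      rw [h1, h2, real_inner_eq_mul]
    · congr 1
      refine integral_congr_ae ?_
      filter_upwards [coeFn_partialL i φ, hη.coeFn_fn_toH10] with x h1 h2
      rw [h1, h2, real_inner_eq_mul]

theorem integrable_fn_mul_grad (φ ξ : H10 Ω) (i : Fin 2) :
    Integrable (fun x => fn φ x * grad ξ x i) (volume.restrict Ω) := by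
  refine (L2.integrable_inner (𝕜 := ℝ) (fn φ) (partialL Ω i ξ)).congr ?_
  filter_upwards [coeFn_partialL i ξ] with x hx
  rw [hx, real_inner_eq_mul]

/-- The divergence of a velocity field. -/
noncomputable def divergence (u : Velocity Ω) : L2 Ω := ∑ i, partialL Ω i (u i)

/-- Integration by parts moves the derivative onto `u`, so only the `L²` norm of `w` appears, not
that of its gradient. -/
theorem abs_integral_velocity_grad_le (u : Velocity Ω) (w : H10 Ω) :
    |∫ x in Ω, ∑ i : Fin 2, fn (u i) x * grad w x i| ≤ ‖divergence u‖ * ‖fn w‖ := by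
  have h : ∫ x in Ω, ∑ i : Fin 2, fn (u i) x * grad w x i = -inner ℝ (divergence u) (fn w) := by
    rw [integral_finsetSum _ fun i _ => integrable_fn_mul_grad (u i) w i, divergence, sum_inner,
      ← Finset.sum_neg_distrib]
    refine Finset.sum_congr rfl fun i _ => ?_
    rw [← inner_fn_partialL, L2.inner_def]
    refine integral_congr_ae ?_
    filter_upwards [coeFn_partialL i w] with x hx
    rw [hx, real_inner_eq_mul]
  rw [h, abs_neg]
  exact abs_real_inner_le_norm _ _

/-- For a divergence-free velocity the convection form is skew-symmetric. -/
theorem convectionForm_add_swap (hΩb : Bornology.IsBounded Ω) {u : Velocity Ω}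
    (hu : DivFree u) (φ ξ : H10 Ω) : convectionForm u φ ξ + convectionForm u ξ φ = 0 := by
  obtain ⟨T, hT, hint⟩ := exists_convectionForm_eq hΩb u
  rw [hT, hT]
  -- By density both arguments may be test functions. Their product is then a test function too, and
  -- the sum of the two forms is `∫ u · ∇(η ζ)`, which the weak gradient of `u` turns into `-∫ (div
  -- u) η ζ`.
  refine H10.induction (P := fun φ => T φ ξ + T ξ φ = 0) ?_ (fun η hη => ?_) φ
  · exact isClosed_eq ((T.continuous.clm_apply continuous_const).add (T ξ).continuous)
      continuous_const
  refine H10.induction (P := fun ξ => T hη.toH10 ξ + T ξ hη.toH10 = 0) ?_ (fun ζ hζ => ?_) ξ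
  · exact isClosed_eq ((T hη.toH10).continuous.add (T.continuous.clm_apply continuous_const))
      continuous_const
  have hprod : ∀ x i, gradient (fun x => η x * ζ x) x i =
      gradient η x i * ζ x + gradient ζ x i * η x := by
    intro x i
    simp only [gradient_apply_eq]
    rw [fderiv_fun_mul (hη.differentiable x) (hζ.differentiable x)]
    simp
    ring
  have hsum : ∀ φ ξ : H10 Ω, T φ ξ = ∑ i, ∫ x in Ω, fn (u i) x * grad φ x i * fn ξ x := by
    intro φ ξ
    rw [← hT, convectionForm, ← integral_finsetSum _ fun i _ => hint φ ξ i]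
    simp only [Finset.sum_mul]
  have hbdd : MemLp (fun x => η x * ζ x) 2 (volume.restrict Ω) := (hη.mul hζ).memLp 2
  rw [hsum, hsum, ← Finset.sum_add_distrib]
  have hi : ∀ i, (∫ x in Ω, fn (u i) x * grad hη.toH10 x i * fn hζ.toH10 x) +
      ∫ x in Ω, fn (u i) x * grad hζ.toH10 x i * fn hη.toH10 x =
      -∫ x in Ω, grad (u i) x i * (η x * ζ x) := by
    intro i
    rw [← hasWeakGradient_grad (u i) _ (hη.mul hζ) i, ← integral_add (hint _ _ i) (hint _ _ i)]
    refine integral_congr_ae ?_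
    filter_upwards [hη.coeFn_fn_toH10, hη.coeFn_grad_toH10, hζ.coeFn_fn_toH10,
      hζ.coeFn_grad_toH10] with x h1 h2 h3 h4
    rw [h1, h2, h3, h4, hprod]
    ring
  have hint2 : ∀ i, Integrable (fun x => grad (u i) x i * (η x * ζ x)) (volume.restrict Ω) := by
    intro i
    refine (L2.integrable_inner (𝕜 := ℝ) (partialL Ω i (u i)) (hbdd.toLp _)).congr ?_
    filter_upwards [coeFn_partialL i (u i), hbdd.coeFn_toLp] with x h1 h2
    rw [h1, h2, real_inner_eq_mul]
  rw [Finset.sum_congr rfl fun i _ => hi i, Finset.sum_neg_distrib,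
    ← integral_finsetSum _ fun i _ => hint2 i, neg_eq_zero]
  refine integral_eq_zero_of_ae ?_
  filter_upwards [hu] with x hx
  rw [← Finset.sum_mul, hx, zero_mul]
  rfl

/-! ### Chain rule and truncation -/

theorem gradient_comp_left {G : ℝ → ℝ} (hG : Differentiable ℝ G) {η : Plane → ℝ}
    (hη : Differentiable ℝ η) (x : Plane) :
    gradient (fun x => G (η x)) x = deriv G (η x) • gradient η x := by
  have h : HasFDerivAt (fun x => G (η x)) (deriv G (η x) • fderiv ℝ η x) x :=
    (hG (η x)).hasDerivAt.comp_hasFDerivAt x (hη x).hasFDerivAt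
  simp only [gradient]
  rw [h.fderiv, map_smul]

theorem memLp_bounded_comp_smul {α E : Type*} [MeasurableSpace α] {μ : Measure α}
    [NormedAddCommGroup E] [NormedSpace ℝ E] {F : ℝ → ℝ} (hF : Measurable F) {L : ℝ}
    (hL : ∀ t, |F t| ≤ L) {f : α → ℝ} (hf : AEStronglyMeasurable f μ) (V : Lp E 2 μ) :
    MemLp (fun x => F (f x) • V x) 2 μ := by
  refine (Lp.memLp V).of_le_mul (c := L)
    ((hF.comp_aemeasurable hf.aemeasurable).aestronglyMeasurable.smul
      (Lp.aestronglyMeasurable V)) (Eventually.of_forall fun x => ?_)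
  rw [norm_smul, Real.norm_eq_abs]
  exact mul_le_mul_of_nonneg_right (hL _) (norm_nonneg _)

/-- The chain rule in `H¹₀(Ω)`. -/
theorem exists_comp {G : ℝ → ℝ} (hG : ContDiff ℝ ∞ G) (hG0 : G 0 = 0) {L : ℝ≥0}
    (hL : ∀ t, |deriv G t| ≤ L) (φ : H10 Ω) :
    ∃ ξ : H10 Ω, (∀ᵐ x ∂(volume.restrict Ω), fn ξ x = G (fn φ x)) ∧
      ∀ᵐ x ∂(volume.restrict Ω), grad ξ x = deriv G (fn φ x) • grad φ x := by
  have hGd : Differentiable ℝ G := hG.differentiable (by simp)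
  have hG' : Continuous (deriv G) := hG.continuous_deriv (by simp)
  have hlip : LipschitzWith L G := lipschitzWith_of_nnnorm_deriv_le hGd fun t => by
    rw [← NNReal.coe_le_coe, coe_nnnorm]
    exact hL t
  obtain ⟨η, hη, hlim⟩ := exists_seq_toH10 φ
  obtain ⟨ns, hns, hae, -⟩ := exists_subseq_tendsto_ae hlim
  have hlim' : Tendsto (fun n => (hη (ns n)).toH10) atTop (𝓝 φ) := hlim.comp hns.tendsto_atTop
  have hmem : ∀ ξ : H10 Ω, MemLp (fun x => deriv G (fn ξ x) • grad φ x) 2 (volume.restrict Ω) :=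
    fun ξ => memLp_bounded_comp_smul hG'.measurable hL (Lp.aestronglyMeasurable _) _
  have hfn : Tendsto (fun n => fn ((hη (ns n)).comp_left hG hG0).toH10) atTop
      (𝓝 (hlip.compLp hG0 (fn φ))) := by
    have h := ((hlip.continuous_compLp (p := 2) (μ := volume.restrict Ω) hG0).comp
      continuous_fn).tendsto φ |>.comp hlim'
    refine h.congr fun n => Lp.ext ?_
    filter_upwards [hlip.coeFn_compLp hG0 (fn (hη (ns n)).toH10), (hη (ns n)).coeFn_fn_toH10,
      ((hη (ns n)).comp_left hG hG0).coeFn_fn_toH10] with x h1 h2 h3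
    rw [h3, ← h2]
    exact h1
  -- The gradient of `G ∘ η n` is compared with the intermediate field `G'(η n) ∇φ`, which converges
  -- by dominated convergence because the factor `∇φ` is fixed.
  have hX : Tendsto (fun n => (hmem (hη (ns n)).toH10).toLp _) atTop
      (𝓝 ((hmem φ).toLp _)) := by
    refine tendsto_L2_of_dominated ((Lp.memLp (grad φ)).norm.const_mul (L : ℝ))
      (fun n => ?_) ?_
    · filter_upwards [(hmem (hη (ns n)).toH10).coeFn_toLp] with x hx
      rw [hx, norm_smul, Real.norm_eq_abs]
      exact mul_le_mul_of_nonneg_right (hL _) (norm_nonneg _)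
    · filter_upwards [hae, (hmem φ).coeFn_toLp,
        ae_all_iff.2 fun n => (hmem (hη (ns n)).toH10).coeFn_toLp] with x h1 h2 h3
      simp only [h2, h3]
      exact ((hG'.tendsto _).comp h1).smul_const _
  have hgrad : Tendsto (fun n => grad ((hη (ns n)).comp_left hG hG0).toH10) atTop
      (𝓝 ((hmem φ).toLp _)) := by
    have hbd : ∀ n, ‖grad ((hη (ns n)).comp_left hG hG0).toH10 -
        (hmem (hη (ns n)).toH10).toLp _‖ ≤ L * ‖grad (hη (ns n)).toH10 - grad φ‖ := by
      intro n
      refine Lp.norm_le_mul_norm_of_ae_le_mul ?_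
      filter_upwards [(hmem (hη (ns n)).toH10).coeFn_toLp, (hη (ns n)).coeFn_fn_toH10,
        (hη (ns n)).coeFn_grad_toH10, ((hη (ns n)).comp_left hG hG0).coeFn_grad_toH10,
        Lp.coeFn_sub (grad ((hη (ns n)).comp_left hG hG0).toH10)
          ((hmem (hη (ns n)).toH10).toLp _),
        Lp.coeFn_sub (grad (hη (ns n)).toH10) (grad φ)] with x h1 h2 h3 h4 h5 h6
      rw [h5, h6, Pi.sub_apply, Pi.sub_apply, h4, h1, h2, h3,
        gradient_comp_left hGd (hη (ns n)).differentiable, ← smul_sub, norm_smul,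
        Real.norm_eq_abs]
      exact mul_le_mul_of_nonneg_right (hL _) (norm_nonneg _)
    have h0 : Tendsto (fun n => (L : ℝ) * ‖grad (hη (ns n)).toH10 - grad φ‖) atTop (𝓝 0) := by
      have := (tendsto_iff_norm_sub_tendsto_zero.1
        ((continuous_grad.tendsto φ).comp hlim')).const_mul (L : ℝ)
      simpa using this
    have h1 := (squeeze_zero_norm hbd h0).add hX
    simpa using h1
  obtain ⟨ξ, h1, h2⟩ := H10.exists_of_tendsto hfn hgrad
  refine ⟨ξ, ?_, ?_⟩
  · rw [h1]
    exact hlip.coeFn_compLp hG0 (fn φ)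
  · rw [h2]
    exact (hmem φ).coeFn_toLp

/-- A smooth approximation of `t ↦ (t - k)⁺`. -/
noncomputable def smoothTrunc (k : ℝ) (n : ℕ) (t : ℝ) : ℝ :=
  ∫ x in k..t, Real.smoothTransition (n * (x - k))

theorem continuous_smoothTransition_scaled (k : ℝ) (n : ℕ) :
    Continuous fun x : ℝ => Real.smoothTransition (n * (x - k)) :=
  Real.smoothTransition.continuous.comp (by fun_prop)

theorem hasDerivAt_smoothTrunc (k : ℝ) (n : ℕ) (t : ℝ) :
    HasDerivAt (smoothTrunc k n) (Real.smoothTransition (n * (t - k))) t :=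
  intervalIntegral.integral_hasDerivAt_right
    ((continuous_smoothTransition_scaled k n).intervalIntegrable _ _)
    (continuous_smoothTransition_scaled k n).aestronglyMeasurable.stronglyMeasurableAtFilter
    (continuous_smoothTransition_scaled k n).continuousAt

theorem deriv_smoothTrunc (k : ℝ) (n : ℕ) :
    deriv (smoothTrunc k n) = fun t => Real.smoothTransition (n * (t - k)) :=
  funext fun t => (hasDerivAt_smoothTrunc k n t).deriv

theorem abs_deriv_smoothTrunc_le (k : ℝ) (n : ℕ) (t : ℝ) : |deriv (smoothTrunc k n) t| ≤ 1 := by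
  rw [deriv_smoothTrunc, abs_of_nonneg (Real.smoothTransition.nonneg _)]
  exact Real.smoothTransition.le_one _

theorem contDiff_smoothTrunc (k : ℝ) (n : ℕ) : ContDiff ℝ ∞ (smoothTrunc k n) := by
  rw [contDiff_infty_iff_deriv, deriv_smoothTrunc]
  exact ⟨fun t => (hasDerivAt_smoothTrunc k n t).differentiableAt,
    Real.smoothTransition.contDiff.comp (by fun_prop)⟩

theorem smoothTrunc_of_le {k t : ℝ} (n : ℕ) (h : t ≤ k) : smoothTrunc k n t = 0 := by
  rw [smoothTrunc, intervalIntegral.integral_congr (g := fun _ => 0)]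
  · simp
  · intro x hx
    rw [uIcc_of_ge h] at hx
    exact Real.smoothTransition.zero_of_nonpos
      (mul_nonpos_of_nonneg_of_nonpos n.cast_nonneg (by linarith [hx.2]))

/-- The limit is `0` at `t = k` itself, so the truncation gets zero gradient on the level set `{ψ =
k}`. -/
theorem tendsto_smoothTransition_scaled (k t : ℝ) :
    Tendsto (fun n : ℕ => Real.smoothTransition (n * (t - k))) atTop
      (𝓝 (if k < t then 1 else 0)) := by
  split_ifs with h
  · refine tendsto_const_nhds.congr' ?_
    have h1 : Tendsto (fun n : ℕ => (n : ℝ) * (t - k)) atTop atTop :=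
      tendsto_natCast_atTop_atTop.atTop_mul_const (sub_pos.2 h)
    filter_upwards [h1.eventually_ge_atTop 1] with n hn
    exact (Real.smoothTransition.one_of_one_le hn).symm
  · refine tendsto_const_nhds.congr fun n => ?_
    exact (Real.smoothTransition.zero_of_nonpos
      (mul_nonpos_of_nonneg_of_nonpos n.cast_nonneg (by linarith))).symm

theorem tendsto_smoothTrunc (k t : ℝ) :
    Tendsto (fun n => smoothTrunc k n t) atTop (𝓝 (max (t - k) 0)) := by
  rcases le_or_gt t k with h | h
  · rw [max_eq_right (by linarith)]
    simp only [smoothTrunc_of_le _ h]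
    exact tendsto_const_nhds
  · have h1 : max (t - k) 0 = ∫ _ in k..t, (1 : ℝ) := by
      rw [max_eq_left (by linarith)]
      simp
    rw [h1]
    refine intervalIntegral.tendsto_integral_filter_of_dominated_convergence (fun _ => 1)
      (Eventually.of_forall fun n =>
        (continuous_smoothTransition_scaled k n).aestronglyMeasurable)
      (Eventually.of_forall fun n => Eventually.of_forall fun x _ => ?_)
      intervalIntegrable_const (Eventually.of_forall fun x hx => ?_)
    · rw [Real.norm_of_nonneg (Real.smoothTransition.nonneg _)]
      exact Real.smoothTransition.le_one _
    · rw [uIoc_of_le h.le] at hx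
      simpa [hx.1] using tendsto_smoothTransition_scaled k x

theorem abs_smoothTrunc_le {k : ℝ} (hk : 0 ≤ k) (n : ℕ) (t : ℝ) : |smoothTrunc k n t| ≤ |t| := by
  rcases le_or_gt t k with h | h
  · simp [smoothTrunc_of_le n h]
  · have h1 := intervalIntegral.norm_integral_le_of_norm_le_const (a := k) (b := t) (C := 1)
      (f := fun x => Real.smoothTransition (n * (x - k))) fun x _ => by
        rw [Real.norm_of_nonneg (Real.smoothTransition.nonneg _)]
        exact Real.smoothTransition.le_one _
    rw [Real.norm_eq_abs, one_mul, abs_of_pos (by linarith : 0 < t - k)] at h1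
    rw [abs_of_pos (by linarith : 0 < t)]
    exact h1.trans (by linarith)

/-- `w = (ψ - k)⁺`, with its weak gradient. -/
def IsTruncation (ψ : H10 Ω) (k : ℝ) (w : H10 Ω) : Prop :=
  (∀ᵐ x ∂(volume.restrict Ω), fn w x = max (fn ψ x - k) 0) ∧
    ∀ᵐ x ∂(volume.restrict Ω), grad w x = if k < fn ψ x then grad ψ x else 0

/-- The chain rule applies to each `smoothTrunc k n`; functions and gradients are dominated by `|ψ|`
and `|∇ψ|`, so both converge in `L²`, and `H10 Ω` is closed. The condition `0 ≤ k` makes the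
truncation vanish at `0`. -/
theorem exists_isTruncation (ψ : H10 Ω) {k : ℝ} (hk : 0 ≤ k) :
    ∃ w : H10 Ω, IsTruncation ψ k w := by
  choose ξ hξ1 hξ2 using fun n => exists_comp (contDiff_smoothTrunc k n)
    (smoothTrunc_of_le n hk) (L := 1) (by simpa using abs_deriv_smoothTrunc_le k n) ψ
  have hf : MemLp (fun x => max (fn ψ x - k) 0) 2 (volume.restrict Ω) := by
    refine (Lp.memLp (fn ψ)).of_le
      (((Lp.aestronglyMeasurable _).sub aestronglyMeasurable_const).sup
        aestronglyMeasurable_const) (Eventually.of_forall fun x => ?_)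
    rw [Real.norm_of_nonneg (le_max_right _ _), Real.norm_eq_abs]
    exact max_le (by linarith [le_abs_self (fn ψ x)]) (abs_nonneg _)
  have hG : MemLp (fun x => (if k < fn ψ x then (1 : ℝ) else 0) • grad ψ x) 2
      (volume.restrict Ω) := by
    refine memLp_bounded_comp_smul (F := fun t => if k < t then (1 : ℝ) else 0) (L := 1)
      (Measurable.ite measurableSet_Ioi measurable_const measurable_const) (fun t => ?_)
      (Lp.aestronglyMeasurable _) _
    split_ifs <;> simp
  have h1 : Tendsto (fun n => fn (ξ n)) atTop (𝓝 (hf.toLp _)) := by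
    refine tendsto_L2_of_dominated (Lp.memLp (fn ψ)).norm (fun n => ?_) ?_
    · filter_upwards [hξ1 n] with x hx
      rw [hx]
      exact abs_smoothTrunc_le hk n _
    · filter_upwards [ae_all_iff.2 hξ1, hf.coeFn_toLp] with x hx h2
      simp only [hx, h2]
      exact tendsto_smoothTrunc k _
  have h2 : Tendsto (fun n => grad (ξ n)) atTop (𝓝 (hG.toLp _)) := by
    refine tendsto_L2_of_dominated (Lp.memLp (grad ψ)).norm (fun n => ?_) ?_
    · filter_upwards [hξ2 n] with x hx
      rw [hx, norm_smul, Real.norm_eq_abs]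
      exact mul_le_of_le_one_left (norm_nonneg _) (abs_deriv_smoothTrunc_le k n _)
    · filter_upwards [ae_all_iff.2 hξ2, hG.coeFn_toLp] with x hx h2
      simp only [hx, h2, deriv_smoothTrunc]
      exact (tendsto_smoothTransition_scaled k _).smul_const _
  obtain ⟨w, hw1, hw2⟩ := H10.exists_of_tendsto h1 h2
  refine ⟨w, ?_, ?_⟩
  · rw [hw1]
    exact hf.coeFn_toLp
  · rw [hw2]
    filter_upwards [hG.coeFn_toLp] with x hx
    rw [hx]
    split_ifs <;> simp

/-! ### The upper bound -/

/-- De Giorgi's iteration, with a bound that depends only on the constants. -/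
theorem exists_forall_eq_zero_of_deGiorgi (D A b R : ℝ) :
    ∃ Λ : ℝ, 0 ≤ Λ ∧ ∀ a : ℝ → ℝ, (∀ k, 0 ≤ a k) → Antitone a →
      (∀ k, 0 < k → k ^ 2 * a k ≤ R ^ 2) →
      (∀ k h, 0 < k → k < h → (h - k) ^ 2 * a h ≤ (D * (A + b * k) * a k) ^ 2) →
      a Λ = 0 := by
  -- The iteration stays at levels `k ≤ 2 * M` with `1 ≤ M`, where `|D * (A + b * k)| ≤ E * M`. The
  -- choice of `δ` gives `4 * E ^ 2 * δ ≤ 1 / 4`, and that of `M` gives `a M ≤ δ`.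
  set E : ℝ := |D| * (|A| + 2 * |b|) with hE
  set δ : ℝ := 1 / (16 * E ^ 2 + 1) with hδ
  have hδ0 : 0 < δ := by positivity
  have hEδ : 16 * E ^ 2 * δ ≤ 1 := by
    rw [hδ, mul_one_div, div_le_one (by positivity)]
    linarith
  set M : ℝ := 1 + R ^ 2 / δ with hM
  have hM1 : 1 ≤ M := by
    have : 0 ≤ R ^ 2 / δ := by positivity
    linarith
  have hM0 : 0 < M := by linarith
  refine ⟨2 * M, by positivity, fun a ha hanti hR hit => ?_⟩
  -- The levels increase from `M` to `2 * M` with gaps halving. Squared gaps cost a factor `4 ^ n`,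
  -- which the quadratic right-hand side more than repays, so `a` drops by `1 / 4` at each step.
  have hind : ∀ n : ℕ, a (M * (2 - (1 / 2) ^ n)) ≤ δ * ((1 / 2) ^ n) ^ 2 := by
    intro n
    induction n with
    | zero =>
      have h1 := hR M hM0
      have h2 : R ^ 2 ≤ M * δ := by
        rw [hM, add_mul, div_mul_cancel₀ _ hδ0.ne']
        linarith
      have h3 : M * δ ≤ M ^ 2 * δ := by nlinarith
      have h4 : a M ≤ δ := le_of_mul_le_mul_left (by linarith) (by positivity : 0 < M ^ 2)
      norm_num
      simpa using h4
    | succ n ih =>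
      set q : ℝ := (1 / 2) ^ n with hq
      have hq0 : 0 < q := by positivity
      have hq1 : q ≤ 1 := pow_le_one₀ (by norm_num) (by norm_num)
      rw [pow_succ, ← hq]
      set k := M * (2 - q) with hk
      set h := M * (2 - q * (1 / 2)) with hh
      have hk0 : 0 < k := by rw [hk]; exact mul_pos hM0 (by linarith)
      have hkM : k ≤ 2 * M := by rw [hk]; nlinarith
      have hhk : h - k = M * q / 2 := by rw [hh, hk]; ring
      have h1 := hit k h hk0 (by
        have : 0 < h - k := by rw [hhk]; positivity
        linarith)
      have h2 : |D * (A + b * k) * a k| ≤ E * M * (δ * q ^ 2) := by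
        rw [abs_mul, abs_mul, abs_of_nonneg (ha k)]
        refine mul_le_mul ?_ ih (ha k) (by positivity)
        rw [hE, mul_assoc]
        refine mul_le_mul_of_nonneg_left ((abs_add_le _ _).trans ?_) (abs_nonneg _)
        rw [abs_mul, abs_of_pos hk0]
        nlinarith [abs_nonneg A, abs_nonneg b, mul_le_mul_of_nonneg_left hkM (abs_nonneg b),
          mul_le_mul_of_nonneg_left hM1 (abs_nonneg A)]
      have h3 := h1.trans (sq_le_sq' (by linarith [abs_le.1 h2 |>.1]) (abs_le.1 h2).2)
      rw [hhk] at h3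
      have h4 : (M * q / 2) ^ 2 * a h ≤ (M * q / 2) ^ 2 * (4 * E ^ 2 * δ * δ * q ^ 2) := by
        refine h3.trans_eq ?_
        ring
      have h5 : a h ≤ 4 * E ^ 2 * δ * δ * q ^ 2 :=
        le_of_mul_le_mul_left h4 (by positivity)
      have h6 : 0 ≤ δ * q ^ 2 := by positivity
      nlinarith
  have hle : ∀ n : ℕ, a (2 * M) ≤ δ * ((1 / 2) ^ n) ^ 2 := fun n =>
    (hanti (by
      have : (0 : ℝ) < (1 / 2) ^ n := by positivity
      nlinarith)).trans (hind n)
  have hlim : Tendsto (fun n : ℕ => δ * ((1 / 2 : ℝ) ^ n) ^ 2) atTop (𝓝 (δ * 0 ^ 2)) :=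
    ((tendsto_pow_atTop_nhds_zero_of_lt_one (by norm_num) (by norm_num)).pow 2).const_mul δ
  refine le_antisymm ?_ (ha _)
  simpa using ge_of_tendsto' hlim hle

/-- Chebyshev's inequality. -/
theorem sq_mul_measureReal_le {α : Type*} [MeasurableSpace α] {μ : Measure α}
    [IsFiniteMeasure μ] {f : Lp ℝ 2 μ} {A : Set α} (hA : MeasurableSet A) {c : ℝ} (hc : 0 ≤ c)
    (h : ∀ᵐ x ∂μ, x ∈ A → c ≤ f x) : c ^ 2 * μ.real A ≤ ‖f‖ ^ 2 := by
  have hint : Integrable (fun x => ‖f x‖ ^ 2) μ := (Lp.memLp f).norm.integrable_sq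
  rw [L2_norm_sq_eq_integral]
  calc c ^ 2 * μ.real A = ∫ x, A.indicator (fun _ => c ^ 2) x ∂μ := by
        rw [integral_indicator_const _ hA, smul_eq_mul, mul_comm]
    _ ≤ ∫ x, ‖f x‖ ^ 2 ∂μ := by
        refine integral_mono_ae ((integrable_const _).indicator hA) hint ?_
        filter_upwards [h] with x hx
        by_cases hxA : x ∈ A
        · rw [indicator_of_mem hxA]
          exact pow_le_pow_left₀ hc ((hx hxA).trans (Real.le_norm_self _)) 2
        · rw [indicator_of_notMem hxA]
          positivity

/-- Functions whose truncations satisfy a Caccioppoli-type inequality are bounded above, with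
a bound that depends only on the constants. -/
theorem exists_forall_fn_le [IsFiniteMeasure (volume.restrict Ω)] {ε : ℝ} (hε : 0 < ε)
    (A b R : ℝ) :
    ∃ Λ : ℝ, 0 ≤ Λ ∧ ∀ ψ : H10 Ω, ‖fn ψ‖ ≤ R →
      (∀ (k : ℝ) (w : H10 Ω), 0 < k → IsTruncation ψ k w →
        ε * ‖grad w‖ ^ 2 ≤ (A + b * k) * ‖fn w‖) →
      ∀ᵐ x ∂(volume.restrict Ω), fn ψ x ≤ Λ := by
  obtain ⟨S, hS, hSob⟩ := exists_norm_fn_le_of_grad_eq_zero_off (Ω := Ω)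
  obtain ⟨Λ, hΛ, hDG⟩ := exists_forall_eq_zero_of_deGiorgi (S ^ 2 / ε) A b R
  refine ⟨Λ, hΛ, fun ψ hψR hψ => ?_⟩
  have hmeas : ∀ k : ℝ, MeasurableSet {x | k < fn ψ x} := fun k =>
    measurableSet_lt measurable_const (Lp.stronglyMeasurable (fn ψ)).measurable
  have h0 := hDG (fun k => (volume.restrict Ω).real {x | k < fn ψ x})
    (fun k => measureReal_nonneg)
    (fun k h hkh => measureReal_mono (fun x hx => lt_of_le_of_lt hkh hx))
    (fun k hk => (sq_mul_measureReal_le (f := fn ψ) (hmeas k) hk.le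
      (Eventually.of_forall fun x hx => le_of_lt hx)).trans
        (pow_le_pow_left₀ (norm_nonneg _) hψR 2)) ?_
  · rw [measureReal_eq_zero_iff] at h0
    rw [ae_iff]
    simpa only [not_le] using h0
  · intro k h hk hkh
    obtain ⟨w, hw⟩ := exists_isTruncation ψ hk.le
    have h1 : (h - k) ^ 2 * (volume.restrict Ω).real {x | h < fn ψ x} ≤ ‖fn w‖ ^ 2 := by
      refine sq_mul_measureReal_le (hmeas h) (by linarith) ?_
      filter_upwards [hw.1] with x hx hxh
      rw [hx]
      have hxh' : h < fn ψ x := hxh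
      exact (by linarith : h - k ≤ fn ψ x - k).trans (le_max_left _ _)
    have h2 := hSob w {x | k < fn ψ x} (hmeas k) (by
      filter_upwards [hw.2] with x hx hxk
      rw [hx]
      exact if_neg hxk)
    have h3 := hψ k w hk hw
    set m := (volume.restrict Ω).real {x | k < fn ψ x} with hm
    have hm0 : 0 ≤ m := measureReal_nonneg
    have h4 : ‖fn w‖ ^ 2 ≤ S ^ 2 * m * ‖grad w‖ ^ 2 := by
      have := pow_le_pow_left₀ (norm_nonneg _) h2 2
      rwa [mul_pow, mul_pow, Real.sq_sqrt hm0, ← mul_assoc] at this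
    -- Sobolev and Caccioppoli combine; cancelling one factor `‖fn w‖` leaves a bound linear in `m`,
    -- whose square is what the iteration needs.
    have h5 : ε * ‖fn w‖ ^ 2 ≤ S ^ 2 * m * ((A + b * k) * ‖fn w‖) := by
      have := mul_le_mul_of_nonneg_left h3 (by positivity : 0 ≤ S ^ 2 * m)
      nlinarith
    refine h1.trans ?_
    rcases (norm_nonneg (fn w)).eq_or_lt with hw0 | hw0
    · rw [← hw0, zero_pow two_ne_zero]
      positivity
    · refine pow_le_pow_left₀ (norm_nonneg _) ?_ 2
      have h6 : ε * ‖fn w‖ ≤ S ^ 2 * m * (A + b * k) :=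
        le_of_mul_le_mul_right (by linarith) hw0
      rw [div_mul_eq_mul_div, div_mul_eq_mul_div, le_div_iff₀ hε]
      linarith

/-! ### Monotone operators -/

/-- Zarantonello's theorem: a strongly monotone Lipschitz map into the dual is onto. -/
theorem exists_eq_of_stronglyMonotone {H : Type*} [NormedAddCommGroup H] [InnerProductSpace ℝ H]
    [CompleteSpace H] {F : H → H →L[ℝ] ℝ} {m : ℝ} {L : ℝ} (hm : 0 < m) (hL : 0 ≤ L)
    (hmono : ∀ x y, m * ‖x - y‖ ^ 2 ≤ (F x - F y) (x - y))
    (hlip : ∀ x y, ‖F x - F y‖ ≤ L * ‖x - y‖) (l : H →L[ℝ] ℝ) : ∃ x, F x = l := by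
  -- Enlarging `L` to `L + m` ensures `m ≤ N`, hence `0 ≤ c`; `t = m / N ^ 2` minimizes the
  -- contraction factor `1 - 2 * t * m + t ^ 2 * N ^ 2`.
  set N : ℝ := L + m with hN
  have hN0 : 0 < N := by positivity
  set t : ℝ := m / N ^ 2 with ht
  have ht0 : 0 < t := by positivity
  let J := (InnerProductSpace.toDual ℝ H).symm
  let T : H → H := fun x => x - t • J (F x - l)
  set c : ℝ := 1 - m ^ 2 / N ^ 2 with hc
  have hc1 : c < 1 := by
    have : 0 < m ^ 2 / N ^ 2 := by positivity
    linarith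
  have hc0 : 0 ≤ c := by
    rw [hc, sub_nonneg, div_le_one (by positivity)]
    exact pow_le_pow_left₀ hm.le (by linarith) 2
  have hT : ∀ x y, ‖T x - T y‖ ≤ √c * ‖x - y‖ := by
    intro x y
    have h1 : T x - T y = (x - y) - t • J (F x - F y) := by
      simp only [T, map_sub, smul_sub]
      abel
    have h2 : inner ℝ (x - y) (J (F x - F y)) = (F x - F y) (x - y) := by
      rw [real_inner_comm]
      exact InnerProductSpace.toDual_symm_apply
    have h3 : ‖J (F x - F y)‖ ≤ N * ‖x - y‖ := by
      rw [LinearIsometryEquiv.norm_map]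
      exact (hlip x y).trans (mul_le_mul_of_nonneg_right (by linarith) (norm_nonneg _))
    have h4 : ‖J (F x - F y)‖ ^ 2 ≤ N ^ 2 * ‖x - y‖ ^ 2 := by
      rw [← mul_pow]
      exact pow_le_pow_left₀ (norm_nonneg _) h3 2
    have h5 : ‖T x - T y‖ ^ 2 ≤ c * ‖x - y‖ ^ 2 := by
      rw [h1, norm_sub_sq_real, inner_smul_right, h2, norm_smul, mul_pow, Real.norm_eq_abs,
        sq_abs]
      have h6 : c * ‖x - y‖ ^ 2 = ‖x - y‖ ^ 2 - 2 * (t * (m * ‖x - y‖ ^ 2)) +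
          t ^ 2 * (N ^ 2 * ‖x - y‖ ^ 2) := by
        rw [hc, ht]
        field_simp
        ring
      rw [h6]
      have h7 := mul_le_mul_of_nonneg_left (hmono x y) ht0.le
      have h8 := mul_le_mul_of_nonneg_left h4 (sq_nonneg t)
      linarith
    rw [← Real.sqrt_sq (norm_nonneg (T x - T y)), ← Real.sqrt_sq (norm_nonneg (x - y)),
      ← Real.sqrt_mul hc0]
    exact Real.sqrt_le_sqrt h5
  have hcontr : ContractingWith (√c).toNNReal T := by
    refine ⟨?_, LipschitzWith.of_dist_le_mul fun x y => ?_⟩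
    · rw [← NNReal.coe_lt_coe, Real.coe_toNNReal _ (Real.sqrt_nonneg c)]
      exact (Real.sqrt_lt_sqrt hc0 hc1).trans_eq Real.sqrt_one
    · rw [dist_eq_norm, dist_eq_norm, Real.coe_toNNReal _ (Real.sqrt_nonneg c)]
      exact hT x y
  have hfix : T (hcontr.fixedPoint T) = hcontr.fixedPoint T := hcontr.fixedPoint_isFixedPt
  refine ⟨hcontr.fixedPoint T, ?_⟩
  have h1 : t • J (F (hcontr.fixedPoint T) - l) = 0 := sub_eq_self.1 hfix
  have h2 := (smul_eq_zero.1 h1).resolve_left ht0.ne'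
  rw [LinearIsometryEquiv.map_eq_zero_iff] at h2
  exact sub_eq_zero.1 h2

/-! ### The problem with a general reaction term -/

theorem exists_bilin_add_skew {H : Type*} [NormedAddCommGroup H] [InnerProductSpace ℝ H]
    (ε : ℝ) (D T : H →L[ℝ] H →L[ℝ] ℝ) :
    ∃ (B : H →L[ℝ] H →L[ℝ] ℝ) (β : ℝ), 0 ≤ β ∧ (∀ x, ‖B x‖ ≤ β * ‖x‖) ∧
      ∀ x y, B x y = ε * D x y + (1 / 2) * (T x y - T y x) :=
  ⟨ε • D + (1 / 2 : ℝ) • (T - T.flip), _, norm_nonneg _, ContinuousLinearMap.le_opNorm _,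
    fun _ _ => rfl⟩

theorem norm_add_sub_add_le {H : Type*} [NormedAddCommGroup H] [InnerProductSpace ℝ H]
    {B : H →L[ℝ] H →L[ℝ] ℝ} {N : H → H →L[ℝ] ℝ} {β K : ℝ} (hβ : ∀ x, ‖B x‖ ≤ β * ‖x‖)
    (hK : ∀ x y, ‖N x - N y‖ ≤ K * ‖x - y‖) (x y : H) :
    ‖B x + N x - (B y + N y)‖ ≤ (β + K) * ‖x - y‖ := by
  rw [show B x + N x - (B y + N y) = B (x - y) + (N x - N y) by rw [map_sub]; abel, add_mul]
  exact (norm_add_le _ _).trans (add_le_add (hβ _) (hK x y))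

/-- The sum of the diffusion and the skew-symmetrized convection form is bounded and bilinear. -/
theorem exists_principalForm (hΩb : Bornology.IsBounded Ω) (ε : ℝ) (u : Velocity Ω) :
    ∃ (B : H10 Ω →L[ℝ] H10 Ω →L[ℝ] ℝ) (β : ℝ), 0 ≤ β ∧ (∀ φ, ‖B φ‖ ≤ β * ‖φ‖) ∧
      (∀ φ ξ, diffusionForm ε φ ξ + skewConvectionForm u φ ξ = B φ ξ) ∧
      ∀ φ, B φ φ = ε * ‖grad φ‖ ^ 2 := by
  obtain ⟨T, hT, -⟩ := exists_convectionForm_eq hΩb u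
  obtain ⟨D, hD⟩ := exists_bilin_inner (gradL Ω) (gradL Ω)
  obtain ⟨B, β, hβ, hle, hB⟩ := exists_bilin_add_skew ε D T
  refine ⟨B, β, hβ, hle, fun φ ξ => ?_, fun φ => ?_⟩
  · simp only [diffusionForm, skewConvectionForm, hT, integral_const_mul]
    rw [hB, hD, L2.inner_def]
    rfl
  · rw [hB, hD, gradL_apply, real_inner_self_eq_norm_sq, sub_self, mul_zero, add_zero]

/-- `ψ` solves the problem with reaction term `f`. -/
def SolvesWith (ε : ℝ) (u : Velocity Ω) (f : ℝ → ℝ) (g : L2 Ω) (ψ : H10 Ω) : Prop :=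
  ∀ φ : H10 Ω, diffusionForm ε ψ φ + skewConvectionForm u ψ φ +
    ∫ x in Ω, f (fn ψ x) * fn φ x = inner ℝ g (fn φ)

theorem inner_compLp_fn {f : ℝ → ℝ} {K : ℝ≥0} (hf : LipschitzWith K f) (hf0 : f 0 = 0)
    (v w : L2 Ω) : (fun x => inner ℝ (hf.compLp hf0 v x) (w x)) =ᵐ[volume.restrict Ω]
      fun x => f (v x) * w x := by
  filter_upwards [hf.coeFn_compLp hf0 v] with x hx
  rw [hx, real_inner_eq_mul]
  rfl

theorem inner_compLp_sub_nonneg {f : ℝ → ℝ} {K : ℝ≥0} (hf : LipschitzWith K f) (hf0 : f 0 = 0)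
    (hmono : Monotone f) (v w : L2 Ω) :
    0 ≤ inner ℝ (hf.compLp hf0 v - hf.compLp hf0 w) (v - w) := by
  rw [L2.inner_def]
  refine integral_nonneg_of_ae ?_
  filter_upwards [hf.coeFn_compLp hf0 v, hf.coeFn_compLp hf0 w, Lp.coeFn_sub v w,
    Lp.coeFn_sub (hf.compLp hf0 v) (hf.compLp hf0 w)] with x h1 h2 h3 h4
  rw [h3, h4, Pi.sub_apply, Pi.sub_apply, h1, h2, real_inner_eq_mul]
  rcases le_total (v x) (w x) with h | h
  · exact mul_nonneg_of_nonpos_of_nonpos (sub_nonpos.2 (hmono h)) (sub_nonpos.2 h)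
  · exact mul_nonneg (sub_nonneg.2 (hmono h)) (sub_nonneg.2 h)

/-- By Poincaré, control of the gradient is coercivity in the full norm. -/
theorem norm_sq_le_mul_norm_grad_sq [IsFiniteMeasure (volume.restrict Ω)]
    (φ : H10 Ω) : ‖φ‖ ^ 2 ≤ (1 + poincareConst Ω ^ 2) * ‖grad φ‖ ^ 2 := by
  have := pow_le_pow_left₀ (norm_nonneg _) (norm_fn_le_poincareConst_mul φ) 2
  rw [mul_pow] at this
  rw [norm_sq_eq]
  linarith

/-- Solvability for a monotone Lipschitz reaction term. -/
theorem exists_solvesWith (hΩb : Bornology.IsBounded Ω) {ε : ℝ} (hε : 0 < ε) (u : Velocity Ω)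
    {f : ℝ → ℝ} {K : ℝ≥0} (hf : LipschitzWith K f) (hf0 : f 0 = 0) (hmono : Monotone f)
    (g : L2 Ω) : ∃ ψ : H10 Ω, SolvesWith ε u f g ψ := by
  have := isFiniteMeasure_restrict hΩb
  obtain ⟨B, β, hβ, hle, hB, hBdiag⟩ := exists_principalForm hΩb ε u
  let N : H10 Ω → H10 Ω →L[ℝ] ℝ := fun ψ => (innerSL ℝ (hf.compLp hf0 (fn ψ))).comp (fnL Ω)
  have hN : ∀ ψ φ, N ψ φ = inner ℝ (hf.compLp hf0 (fn ψ)) (fn φ) := fun _ _ => rfl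
  have hcP : 0 < 1 + poincareConst Ω ^ 2 := by positivity
  have hstrong : ∀ φ ξ, ε / (1 + poincareConst Ω ^ 2) * ‖φ - ξ‖ ^ 2 ≤
      (B φ + N φ - (B ξ + N ξ)) (φ - ξ) := by
    intro φ ξ
    have h1 : (B φ + N φ - (B ξ + N ξ)) (φ - ξ) = B (φ - ξ) (φ - ξ) +
        inner ℝ (hf.compLp hf0 (fn φ) - hf.compLp hf0 (fn ξ)) (fn φ - fn ξ) := by
      rw [inner_sub_left, ← fn_sub, ← hN, ← hN, map_sub B]
      simp only [sub_apply, add_apply]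
      ring
    rw [h1, hBdiag, div_mul_eq_mul_div, div_le_iff₀ hcP]
    have h2 := mul_le_mul_of_nonneg_left (norm_sq_le_mul_norm_grad_sq (φ - ξ)) hε.le
    have h3 := mul_nonneg (inner_compLp_sub_nonneg hf hf0 hmono (fn φ) (fn ξ)) hcP.le
    linarith
  have hlip : ∀ φ ξ, ‖B φ + N φ - (B ξ + N ξ)‖ ≤ (β + K) * ‖φ - ξ‖ := by
    intro φ ξ
    refine norm_add_sub_add_le hle (fun φ ξ => ?_) φ ξ
    refine ContinuousLinearMap.opNorm_le_bound _ (by positivity) fun ζ => ?_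
    rw [sub_apply, hN, hN, ← inner_sub_left]
    refine (norm_inner_le_norm _ _).trans (mul_le_mul ?_ (norm_fn_le ζ) (norm_nonneg _)
      (by positivity))
    refine (hf.norm_compLp_sub_le hf0 _ _).trans ?_
    rw [← fn_sub]
    exact mul_le_mul_of_nonneg_left (norm_fn_le _) K.2
  obtain ⟨ψ, hψ⟩ := exists_eq_of_stronglyMonotone (F := fun ψ => B ψ + N ψ) (by positivity)
    (by positivity) hstrong hlip ((innerSL ℝ g).comp (fnL Ω))
  refine ⟨ψ, fun φ => ?_⟩
  rw [hB, ← integral_congr_ae (inner_compLp_fn hf hf0 (fn ψ) (fn φ)), ← L2.inner_def]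
  exact DFunLike.congr_fun hψ φ

/-- The energy estimate. -/
theorem SolvesWith.norm_grad_le (hΩb : Bornology.IsBounded Ω) {ε : ℝ} (hε : 0 < ε)
    {u : Velocity Ω} {f : ℝ → ℝ} {g : L2 Ω} {ψ : H10 Ω} (h : SolvesWith ε u f g ψ)
    (hf : ∀ t, 0 ≤ f t * t) : ‖grad ψ‖ ≤ poincareConst Ω / ε * ‖g‖ := by
  have := isFiniteMeasure_restrict hΩb
  obtain ⟨B, -, -, -, hB, hBdiag⟩ := exists_principalForm hΩb ε u
  have h1 := h ψ
  rw [hB, hBdiag] at h1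
  have h2 : 0 ≤ ∫ x in Ω, f (fn ψ x) * fn ψ x := integral_nonneg fun x => hf _
  have h3 : ε * ‖grad ψ‖ ^ 2 ≤ ‖g‖ * (poincareConst Ω * ‖grad ψ‖) :=
    (by linarith : _ ≤ inner ℝ g (fn ψ)).trans ((real_inner_le_norm _ _).trans
      (mul_le_mul_of_nonneg_left (norm_fn_le_poincareConst_mul ψ) (norm_nonneg _)))
  rw [div_mul_eq_mul_div, le_div_iff₀ hε]
  rcases (norm_nonneg (grad ψ)).eq_or_lt with h0 | h0
  · rw [← h0, zero_mul]
    exact mul_nonneg poincareConst_nonneg (norm_nonneg _)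
  · exact le_of_mul_le_mul_right (by linarith) h0

/-- This symmetry turns upper bounds into lower bounds, since `t ↦ -f (-t)` satisfies the same sign
condition as `f`. -/
theorem SolvesWith.neg (hΩb : Bornology.IsBounded Ω) {ε : ℝ} {u : Velocity Ω} {f : ℝ → ℝ}
    {g : L2 Ω} {ψ : H10 Ω} (h : SolvesWith ε u f g ψ) :
    SolvesWith ε u (fun t => -f (-t)) (-g) (-ψ) := by
  obtain ⟨B, -, -, -, hB, -⟩ := exists_principalForm hΩb ε u
  intro φ
  have h1 := h φ
  rw [hB] at h1 ⊢
  have h2 : ∫ x in Ω, -f (-fn (-ψ) x) * fn φ x = -∫ x in Ω, f (fn ψ x) * fn φ x := by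
    rw [← integral_neg]
    refine integral_congr_ae ?_
    filter_upwards [Lp.coeFn_neg (fn ψ)] with x hx
    rw [fn_neg, hx, Pi.neg_apply, neg_neg, neg_mul]
  rw [h2, inner_neg_left, ← h1, map_neg, neg_apply]
  ring

/-- Testing with a truncation of the solution. -/
theorem SolvesWith.caccioppoli (hΩb : Bornology.IsBounded Ω) {ε : ℝ} {u : Velocity Ω}
    {f : ℝ → ℝ} {g : L2 Ω} {ψ : H10 Ω} (h : SolvesWith ε u f g ψ) (hf : ∀ t, 0 ≤ f t * t)
    {k : ℝ} {w : H10 Ω} (hk : 0 < k) (hw : IsTruncation ψ k w) :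
    ε * ‖grad w‖ ^ 2 ≤ (‖g‖ + ‖divergence u‖ / 2 * k) * ‖fn w‖ := by
  obtain ⟨T, hT, hint⟩ := exists_convectionForm_eq hΩb u
  have h1 : diffusionForm ε ψ w = ε * ‖grad w‖ ^ 2 := by
    rw [diffusionForm, integral_const_mul, L2_norm_sq_eq_integral]
    congr 1
    refine integral_congr_ae ?_
    filter_upwards [hw.2] with x hx
    rw [hx]
    split_ifs
    · exact real_inner_self_eq_norm_sq _
    · simp
  have h2 : convectionForm u ψ w = convectionForm u w w := by
    refine integral_congr_ae ?_
    filter_upwards [hw.1, hw.2] with x hx hx'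
    rw [hx']
    split_ifs with hk'
    · rfl
    · rw [hx, max_eq_right (by linarith), mul_zero, mul_zero]
  -- Where `∇w ≠ 0` one has `ψ = w + k`. In the skew form the `w, w` terms cancel and only `k` times
  -- the flux integral remains.
  have h3 : convectionForm u w ψ = convectionForm u w w +
      k * ∫ x in Ω, ∑ i : Fin 2, fn (u i) x * grad w x i := by
    rw [convectionForm, convectionForm, ← integral_const_mul, ← integral_add]
    · refine integral_congr_ae ?_
      filter_upwards [hw.1, hw.2] with x hx hx'
      rw [hx']
      split_ifs with hk'
      · rw [hx, max_eq_left (by linarith)]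
        ring
      · simp
    · simp only [Finset.sum_mul]
      exact integrable_finsetSum _ fun i _ => hint w w i
    · exact (integrable_finsetSum _ fun i _ => integrable_fn_mul_grad (u i) w i).const_mul k
  have h4 : 0 ≤ ∫ x in Ω, f (fn ψ x) * fn w x := by
    refine integral_nonneg_of_ae ?_
    filter_upwards [hw.1] with x hx
    rw [hx]
    rcases le_or_gt (fn ψ x) 0 with h0 | h0
    · rw [max_eq_right (by linarith), mul_zero]
      rfl
    · exact mul_nonneg (nonneg_of_mul_nonneg_left (hf _) h0) (le_max_right _ _)
  have h5 := h w
  rw [h1, skewConvectionForm, h2, h3] at h5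
  have h6 := real_inner_le_norm g (fn w)
  have h7 := (le_abs_self _).trans (abs_integral_velocity_grad_le u w)
  have h8 := mul_le_mul_of_nonneg_left h7 hk.le
  linarith

/-- Solutions are bounded by a constant that does not depend on the reaction term. -/
theorem exists_forall_abs_fn_le (hΩb : Bornology.IsBounded Ω) {ε : ℝ} (hε : 0 < ε)
    (u : Velocity Ω) (g : L2 Ω) :
    ∃ Λ : ℝ, 0 ≤ Λ ∧ ∀ (f : ℝ → ℝ) (ψ : H10 Ω), (∀ t, 0 ≤ f t * t) → SolvesWith ε u f g ψ →
      ∀ᵐ x ∂(volume.restrict Ω), |fn ψ x| ≤ Λ := by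
  have := isFiniteMeasure_restrict hΩb
  -- The last argument bounds `‖fn ψ‖` by the energy estimate and Poincaré. All constants depend on
  -- `g` only through its norm, so the same `Λ` serves `-g`.
  obtain ⟨Λ, hΛ, hbd⟩ := exists_forall_fn_le (Ω := Ω) hε ‖g‖ (‖divergence u‖ / 2)
    (poincareConst Ω * (poincareConst Ω / ε * ‖g‖))
  have hupper : ∀ (f : ℝ → ℝ) (v : L2 Ω) (ψ : H10 Ω), ‖v‖ = ‖g‖ → (∀ t, 0 ≤ f t * t) →
      SolvesWith ε u f v ψ → ∀ᵐ x ∂(volume.restrict Ω), fn ψ x ≤ Λ := by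
    intro f v ψ hv hf h
    refine hbd ψ ((norm_fn_le_poincareConst_mul ψ).trans
      (mul_le_mul_of_nonneg_left ?_ poincareConst_nonneg)) fun k w hk hw => ?_
    · rw [← hv]
      exact h.norm_grad_le hΩb hε hf
    · rw [← hv]
      exact h.caccioppoli hΩb hf hk hw
  refine ⟨Λ, hΛ, fun f ψ hf h => ?_⟩
  filter_upwards [hupper f g ψ rfl hf h, hupper _ (-g) (-ψ) (norm_neg g)
    (fun t => by simpa using hf (-t)) (h.neg hΩb), Lp.coeFn_neg (fn ψ)] with x h1 h2 h3
  rw [fn_neg, h3, Pi.neg_apply] at h2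
  exact abs_le.2 ⟨by linarith, h1⟩

/-! ### The Poisson-Boltzmann reaction term -/

theorem strictMono_kappa {α₀ α₁ : ℝ} (h₀ : 0 < α₀) (h₁ : 0 < α₁) :
    StrictMono (kappa α₀ α₁) := fun _ _ h =>
  mul_lt_mul_of_pos_left (Real.sinh_strictMono (mul_lt_mul_of_pos_left h h₁)) h₀

/-- `κ` frozen outside `[-M, M]`. -/
noncomputable def cutKappa (α₀ α₁ M t : ℝ) : ℝ := kappa α₀ α₁ (max (-M) (min M t))

theorem cutKappa_eq {α₀ α₁ M t : ℝ} (h : |t| ≤ M) : cutKappa α₀ α₁ M t = kappa α₀ α₁ t := by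
  rw [cutKappa, min_eq_right (abs_le.1 h).2, max_eq_right (abs_le.1 h).1]

theorem cutKappa_zero {α₀ α₁ M : ℝ} (hM : 0 ≤ M) : cutKappa α₀ α₁ M 0 = 0 := by
  rw [cutKappa_eq (by simpa using hM), kappa, mul_zero, Real.sinh_zero, mul_zero]

theorem monotone_cutKappa {α₀ α₁ : ℝ} (h₀ : 0 < α₀) (h₁ : 0 < α₁) (M : ℝ) :
    Monotone (cutKappa α₀ α₁ M) := fun _ _ h =>
  (strictMono_kappa h₀ h₁).monotone (max_le_max le_rfl (min_le_min le_rfl h))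

theorem cutKappa_mul_nonneg {α₀ α₁ M : ℝ} (h₀ : 0 < α₀) (h₁ : 0 < α₁) (hM : 0 ≤ M) (t : ℝ) :
    0 ≤ cutKappa α₀ α₁ M t * t := by
  have h0 := cutKappa_zero (α₀ := α₀) (α₁ := α₁) hM
  rcases le_total t 0 with h | h
  · exact mul_nonneg_of_nonpos_of_nonpos (h0 ▸ monotone_cutKappa h₀ h₁ M h) h
  · exact mul_nonneg (h0 ▸ monotone_cutKappa h₀ h₁ M h) h

/-- A smooth function is Lipschitz on the compact interval, and clamping to that interval is
1-Lipschitz. -/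
theorem exists_lipschitzWith_cutKappa (α₀ α₁ : ℝ) {M : ℝ} (hM : 0 ≤ M) :
    ∃ K : ℝ≥0, LipschitzWith K (cutKappa α₀ α₁ M) := by
  have hsmooth : ContDiff ℝ 1 (kappa α₀ α₁) :=
    contDiff_const.mul (Real.contDiff_sinh.comp (contDiff_const.mul contDiff_id))
  obtain ⟨K, hK⟩ := hsmooth.contDiffOn.exists_lipschitzOnWith one_ne_zero
    (convex_Icc (-M) M) isCompact_Icc
  refine ⟨K * 1, lipschitzOnWith_univ.1 (hK.comp (t := Icc (-M) M)
    (f := fun t => max (-M) (min M t)) (LipschitzWith.lipschitzOnWith ?_) fun t _ => ?_)⟩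
  · exact (LipschitzWith.id.const_min M).const_max (-M)
  · exact ⟨le_max_left _ _, max_le (by linarith) (min_le_left _ _)⟩

/-! ### Existence and uniqueness -/

/-- A solution bounded by the cutting level never meets the cut, and `κ(ψ)` is then in `L²`. -/
theorem SolvesWith.isWeakSolution {ε α₀ α₁ M : ℝ} (hM : 0 ≤ M) {u : Velocity Ω} {g : L2 Ω}
    {ψ : H10 Ω} (h : SolvesWith ε u (cutKappa α₀ α₁ M) g ψ)
    (hψ : ∀ᵐ x ∂(volume.restrict Ω), |fn ψ x| ≤ M) :
    IsWeakSolution ε α₀ α₁ (skewConvectionForm u) g ψ := by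
  obtain ⟨K, hK⟩ := exists_lipschitzWith_cutKappa α₀ α₁ hM
  intro φ
  have hae : (fun x => cutKappa α₀ α₁ M (fn ψ x) * fn φ x) =ᵐ[volume.restrict Ω]
      fun x => kappa α₀ α₁ (fn ψ x) * fn φ x := by
    filter_upwards [hψ] with x hx
    rw [cutKappa_eq hx]
  refine ⟨(L2.integrable_inner (𝕜 := ℝ) _ _).congr
    ((inner_compLp_fn hK (cutKappa_zero hM) (fn ψ) (fn φ)).trans hae), ?_⟩
  have h1 := h φ
  rw [integral_congr_ae hae, L2.inner_def] at h1
  simpa only [real_inner_eq_mul, reactionForm] using h1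

/-- Uniqueness of weak solutions. -/
theorem IsWeakSolution.eq (hΩb : Bornology.IsBounded Ω) {ε α₀ α₁ : ℝ} (hε : 0 < ε)
    (h₀ : 0 < α₀) (h₁ : 0 < α₁) {u : Velocity Ω} {g : L2 Ω} {ψ ψ' : H10 Ω}
    (h : IsWeakSolution ε α₀ α₁ (skewConvectionForm u) g ψ)
    (h' : IsWeakSolution ε α₀ α₁ (skewConvectionForm u) g ψ') : ψ' = ψ := by
  have := isFiniteMeasure_restrict hΩb
  obtain ⟨B, -, -, -, hB, hBdiag⟩ := exists_principalForm hΩb ε u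
  -- Testing with the difference needs no boundedness of either solution: the integrability built
  -- into `IsWeakSolution` lets the reaction integrals be subtracted.
  obtain ⟨hi, he⟩ := h (ψ' - ψ)
  obtain ⟨hi', he'⟩ := h' (ψ' - ψ)
  rw [hB] at he he'
  have h2 : B (ψ' - ψ) (ψ' - ψ) = B ψ' (ψ' - ψ) - B ψ (ψ' - ψ) := by
    rw [map_sub B]
    rfl
  have h3 : 0 ≤ reactionForm α₀ α₁ ψ' (ψ' - ψ) - reactionForm α₀ α₁ ψ (ψ' - ψ) := by
    rw [reactionForm, reactionForm, ← integral_sub hi' hi]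
    refine integral_nonneg_of_ae ?_
    filter_upwards [Lp.coeFn_sub (fn ψ') (fn ψ)] with x hx
    rw [fn_sub, hx, Pi.sub_apply, ← sub_mul]
    rcases le_total (fn ψ x) (fn ψ' x) with hle | hle
    · exact mul_nonneg (sub_nonneg.2 ((strictMono_kappa h₀ h₁).monotone hle)) (sub_nonneg.2 hle)
    · exact mul_nonneg_of_nonpos_of_nonpos
        (sub_nonpos.2 ((strictMono_kappa h₀ h₁).monotone hle)) (sub_nonpos.2 hle)
  rw [hBdiag] at h2
  have h4 : ‖grad (ψ' - ψ)‖ ^ 2 ≤ 0 := nonpos_of_mul_nonpos_right (by linarith) hε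
  have h5 := (norm_sq_le_mul_norm_grad_sq (ψ' - ψ)).trans
    (mul_nonpos_of_nonneg_of_nonpos (by positivity) h4)
  exact sub_eq_zero.1 (norm_eq_zero.1 (pow_eq_zero_iff two_ne_zero |>.1
    (le_antisymm h5 (sq_nonneg _))))

theorem skewConvectionForm_eq_of_divFree (hΩb : Bornology.IsBounded Ω) {u : Velocity Ω}
    (hu : DivFree u) : skewConvectionForm u = convectionForm u := by
  funext φ ξ
  have := convectionForm_add_swap hΩb hu φ ξ
  rw [skewConvectionForm]
  linarith

end
end PoissonBoltzmann

theorem mainTheorem6 (Ω : Set PoissonBoltzmann.Plane) (hΩ : IsOpen Ω)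
    (hΩb : Bornology.IsBounded Ω) (ε α₀ α₁ : ℝ) (hε : 0 < ε) (hα₀ : 0 < α₀) (hα₁ : 0 < α₁)
    (g : PoissonBoltzmann.L2 Ω) (u : PoissonBoltzmann.Velocity Ω) :
    ∃ ψ : PoissonBoltzmann.H10 Ω,
      PoissonBoltzmann.IsWeakSolution ε α₀ α₁ (PoissonBoltzmann.skewConvectionForm u) g ψ ∧
      (∀ ψ' : PoissonBoltzmann.H10 Ω,
        PoissonBoltzmann.IsWeakSolution ε α₀ α₁ (PoissonBoltzmann.skewConvectionForm u) g ψ' →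
          ψ' = ψ) ∧
      PoissonBoltzmann.IsBoundedPotential ψ ∧
      ‖PoissonBoltzmann.grad ψ‖ ≤ PoissonBoltzmann.poincareConst Ω / ε * ‖g‖ ∧
      (PoissonBoltzmann.DivFree u →
        PoissonBoltzmann.IsWeakSolution ε α₀ α₁ (PoissonBoltzmann.convectionForm u) g ψ ∧
        ∀ ψ' : PoissonBoltzmann.H10 Ω,
          PoissonBoltzmann.IsWeakSolution ε α₀ α₁ (PoissonBoltzmann.convectionForm u) g ψ' →
            ψ' = ψ) := by
  -- `Λ` is fixed before the reaction term, so cutting `kappa` at `Λ` is not circular.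
  obtain ⟨Λ, hΛ, hbd⟩ := PoissonBoltzmann.exists_forall_abs_fn_le hΩb hε u g
  obtain ⟨K, hK⟩ := PoissonBoltzmann.exists_lipschitzWith_cutKappa α₀ α₁ hΛ
  have hsign := PoissonBoltzmann.cutKappa_mul_nonneg hα₀ hα₁ hΛ
  obtain ⟨ψ, hψ⟩ := PoissonBoltzmann.exists_solvesWith hΩb hε u hK
    (PoissonBoltzmann.cutKappa_zero hΛ) (PoissonBoltzmann.monotone_cutKappa hα₀ hα₁ Λ) g
  have habs := hbd _ ψ hsign hψ
  have hsol := hψ.isWeakSolution hΛ habs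
  refine ⟨ψ, hsol, fun ψ' h => hsol.eq hΩb hε hα₀ hα₁ h,
    ⟨-Λ, Λ, neg_nonpos.2 hΛ, hΛ, habs.mono fun x hx => abs_le.1 hx⟩,
    hψ.norm_grad_le hΩb hε hsign, fun hu => ?_⟩
  rw [← PoissonBoltzmann.skewConvectionForm_eq_of_divFree hΩb hu]
  exact ⟨hsol, fun ψ' h => hsol.eq hΩb hε hα₀ hα₁ h⟩
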